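/- **Problem.** Let $\xi$ be a random variable, $f(\cdot;\xi):\mathbb R^n\to\mathbb R$, $F(x)=\mathbb E_\xi[f(x;\xi)]$, let $r:\mathbb R^n\to\mathbb R\cup\{+\infty\}$ be proper, closed and convex (possibly nonsmooth), $\operatorname{dom}(r)=\{x: r(x)<\infty\}$, and let $\phi=F+r$ with $\phi^*=\inf_{x}\phi(x)>-\infty$. For $a>0$ put $\operatorname{prox}_{ar}(z)=\arg\min_y\{r(y)+\frac1{2a}\|y-z\|^2\}$, and let $\phi_\lambda(x)=\min_y\{\phi(y)+\frac1{2\lambda}\|y-x\|^2\}$ be the Moreau envelope of $\phi$. **Algorithm.** Choose $x^{(0)}\in\operatorname{dom}(r)$ and set $x^{(1)}=x^{(0)}$. For $k=1,\dots,K$ let $g^{(k)}=\nabla f(x^{(k-\tau_k)};\xi_k)$, where $\xi_k$ is a fresh sample of $\xi$ (independent of the past) and $\tau_k$ is a delay (fixed, or random and determined before $\xi_k$ is drawn), and $$x^{(k+1)}=\operatorname{prox}_{\alpha_k r}\big(x^{(k)}-\alpha_k g^{(k)}+\beta_k(x^{(k)}-x^{(k-1)})\big).$$ **Assumptions.** (i)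 $\mathbb E_{\xi_k}[g^{(k)}]=\nabla F(x^{(k-\tau_k)})$ for each $k$. (ii) $F$ is differentiable at the points of $\operatorname{dom}(r)$, and $\|\nabla F(x)-\nabla F(y)\|\le\rho\|x-y\|$ for all $x,y\in\operatorname{dom}(r)$, where $\rho\ge0$. (iii) $\mathbb E_\xi\|\nabla f(x;\xi)-\nabla F(x)\|^2\le\sigma^2$ for all $x\in\operatorname{dom}(r)$, where $\sigma\ge0$. (iv) $\tau_k\le\tau$ for all $k$, where $\tau$ is a nonnegative integer. **Theorem.** Let $\overline\rho>\rho$, let $K\ge1$ be the number of iterations, and let $\alpha_k=\frac{\alpha}{\sqrt K}$ and $\beta_k=\frac{\beta}{K^{1/4}}$ for $k=1,\dots,K$, where $\alpha>0$ and $\beta\ge0$ are such that $\frac{\alpha}{\sqrt K}\le\frac1{\overline\rho}$ and $$\tilde\gamma:=\frac12-\frac{\alpha\rho}{2\sqrt K}-\frac{\tau^2\alpha^2\rho^2}{K}-\frac{\beta}{K^{1/4}}>0.$$ Let $T$ be drawn from $\{1,\dots,K\}$, independently of the iterates, with $\mathrm{Prob}(T=k)=\alpha_k/\sum_{j=1}^K\alpha_j$.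 Then $\phi_{1/\overline\rho}$ is differentiable on $\mathbb R^n$, $\|\nabla\phi_{1/\overline\rho}(x^{(T)})\|^2$ is integrable, and $$\begin{aligned}\mathbb E\big\|\nabla\phi_{1/\overline\rho}(x^{(T)})\big\|^2\le{}&\frac{8\overline\rho}{(\overline\rho-\rho)\alpha\sqrt K}\Bigg[\phi_{1/\overline\rho}(x^{(1)})-\phi^*+\frac{\sigma^2\overline\rho\alpha^2}{2}\\&+\frac1{\tilde\gamma}\bigg(\overline\rho\Big(2+\frac{4\sqrt K}{\alpha(\overline\rho-\rho)}\Big)\frac{\beta^2}{\sqrt K}+\frac{\tau^2\overline\rho\rho^2}{2}\Big(\frac{\alpha^2}{K}+\frac{\alpha}{(\overline\rho-\rho)\sqrt K}\Big)\bigg)\Big(\frac{\alpha}{\sqrt K}\big(\phi(x^{(1)})-\phi^*\big)+\alpha^2\sigma^2\Big)\Bigg].\end{aligned}$$ -/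

import Mathlib

namespace InertialSGM

open scoped MeasureTheory

/-- The Euclidean space `ℝⁿ`. -/
abbrev Vec (n : ℕ) : Type := EuclideanSpace ℝ (Fin n)

/-- The effective domain `dom h` of an extended-real-valued function. -/
def effDom {n : ℕ} (h : Vec n → EReal) : Set (Vec n) := {x | h x < ⊤}

/-- `h : ℝⁿ → ℝ ∪ {+∞}` is proper, closed (lower semicontinuous) and convex; convexity is
convexity of the epigraph. -/
structure ProperClosedConvex {n : ℕ} (h : Vec n → EReal) : Prop where
  ne_bot : ∀ x, h x ≠ ⊥
  nonempty_dom : (effDom h).Nonempty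
  lsc : LowerSemicontinuous h
  convex_epi : Convex ℝ {p : Vec n × ℝ | h p.1 ≤ (p.2 : EReal)}

/-- `p = prox_{a h}(z)`, i.e. `p` minimizes `y ↦ h y + ‖y - z‖² / (2a)` over `ℝⁿ`. -/
def IsProx {n : ℕ} (a : ℝ) (h : Vec n → EReal) (z p : Vec n) : Prop :=
  ∀ y : Vec n, h p + ((1 / (2 * a) * ‖p - z‖ ^ 2 : ℝ) : EReal)
    ≤ h y + ((1 / (2 * a) * ‖y - z‖ ^ 2 : ℝ) : EReal)

/-- The Moreau envelope `φ_t(x) = inf_y { φ(y) + ‖y - x‖² / (2t) }`, as a real number. -/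
noncomputable def moreau {n : ℕ} (t : ℝ) (φ : Vec n → EReal) (x : Vec n) : ℝ :=
  (⨅ y : Vec n, φ y + ((1 / (2 * t) * ‖y - x‖ ^ 2 : ℝ) : EReal)).toReal

/-- The optimal value `φ^* = inf φ`, as a real number. -/
noncomputable def optVal {n : ℕ} (φ : Vec n → EReal) : ℝ := (⨅ x : Vec n, φ x).toReal

/-- The expected loss `F(x) = E_ξ f(x; ξ)`, where `D` is the law of `ξ`. -/
noncomputable def expLoss {n : ℕ} {Ξ : Type*} [MeasurableSpace Ξ]
    (D : MeasureTheory.Measure Ξ) (f : Vec n → Ξ → ℝ) (x : Vec n) : ℝ :=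
  ∫ s, f x s ∂D

/-- The composite objective `φ = F + r`. -/
noncomputable def objective {n : ℕ} (F : Vec n → ℝ) (r : Vec n → EReal) (x : Vec n) : EReal :=
  (F x : EReal) + r x

/-- The sample gradient `∇f(x; s)` with respect to `x`. -/
noncomputable def sampleGrad {n : ℕ} {Ξ : Type*} (f : Vec n → Ξ → ℝ) (x : Vec n) (s : Ξ) :
    Vec n :=
  gradient (fun y => f y s) x

/-- `F` is `ρ`-smooth in `S`. -/
structure SmoothIn {n : ℕ} (ρ : ℝ) (F : Vec n → ℝ) (S : Set (Vec n)) : Prop where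
  differentiableAt : ∀ x ∈ S, DifferentiableAt ℝ F x
  lipschitz : ∀ x ∈ S, ∀ y ∈ S, ‖gradient F x - gradient F y‖ ≤ ρ * ‖x - y‖

/-- Bounded variance on `S`: `E_ξ ‖∇f(x; ξ) - ∇F(x)‖² ≤ σ²` for all `x ∈ S`. -/
def BoundedVariance {n : ℕ} {Ξ : Type*} [MeasurableSpace Ξ] (D : MeasureTheory.Measure Ξ)
    (f : Vec n → Ξ → ℝ) (σ : ℝ) (S : Set (Vec n)) : Prop :=
  ∀ x ∈ S, ∫⁻ s, ENNReal.ofReal (‖sampleGrad f x s - gradient (expLoss D f) x‖ ^ 2) ∂D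
    ≤ ENNReal.ofReal (σ ^ 2)

/-- The randomness of a run of `K` iterations: `ℱ k` is the information available right before
the `k`-th sample is drawn, the delay `τ_k` belongs to it (in particular it may be deterministic),
and `ξ_k` is a fresh sample with law `D`. -/
structure IsSampling {Ω Ξ : Type*} {mΩ : MeasurableSpace Ω} [MeasurableSpace Ξ]
    (P : MeasureTheory.Measure Ω) (D : MeasureTheory.Measure Ξ)
    (ℱ : MeasureTheory.Filtration ℕ mΩ) (ξ : ℕ → Ω → Ξ) (delay : ℕ → Ω → ℕ) (K : ℕ) : Prop where
  delay_meas : ∀ k ∈ Finset.Icc 1 K, Measurable[ℱ k] (delay k)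
  sample_meas : ∀ k ∈ Finset.Icc 1 K, Measurable[ℱ (k + 1)] (ξ k)
  sample_law : ∀ k ∈ Finset.Icc 1 K, MeasureTheory.Measure.map (ξ k) P = D
  sample_indep : ∀ k ∈ Finset.Icc 1 K,
    ProbabilityTheory.Indep (MeasurableSpace.comap (ξ k) inferInstance) (ℱ k) P

/-- `x⁽⁰⁾, x⁽¹⁾, …, x⁽ᴷ⁺¹⁾` are the iterates of the distributed stochastic inertial (proximal)
gradient method with stepsizes `a k`, inertial parameters `b k`, samples `ξ k` and delays
`delay k`. The subtraction `k - delay k ω` is that of `ℕ`: a delay reaching behind the start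
refers to the starting point. -/
structure IsInertialRun {n : ℕ} {Ω Ξ : Type*} (f : Vec n → Ξ → ℝ) (r : Vec n → EReal)
    (a b : ℕ → ℝ) (ξ : ℕ → Ω → Ξ) (delay : ℕ → Ω → ℕ) (K : ℕ) (x₀ : Vec n)
    (x : ℕ → Ω → Vec n) : Prop where
  init_dom : x₀ ∈ effDom r
  init_zero : ∀ ω, x 0 ω = x₀
  init_one : ∀ ω, x 1 ω = x₀
  step : ∀ k ∈ Finset.Icc 1 K, ∀ ω,
    IsProx (a k) r
      (x k ω - a k • sampleGrad f (x (k - delay k ω) ω) (ξ k ω) + b k • (x k ω - x (k - 1) ω))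
      (x (k + 1) ω)

/-- Unbiasedness along the run: `E_{ξ_k}[g⁽ᵏ⁾] = ∇F(x⁽ᵏ⁻ᵗ⁾)` with `t = τ_k`, where
`g⁽ᵏ⁾ = ∇f(x⁽ᵏ⁻ᵗ⁾; ξ_k)` and `E_{ξ_k}` integrates over the fresh sample only. -/
def UnbiasedAlong {n : ℕ} {Ω Ξ : Type*} [MeasurableSpace Ω] [MeasurableSpace Ξ]
    (P : MeasureTheory.Measure Ω) (D : MeasureTheory.Measure Ξ) (f : Vec n → Ξ → ℝ)
    (delay : ℕ → Ω → ℕ) (K : ℕ) (x : ℕ → Ω → Vec n) : Prop :=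
  ∀ k ∈ Finset.Icc 1 K, ∀ᵐ ω ∂P,
    ∫ s, sampleGrad f (x (k - delay k ω) ω) s ∂D
      = gradient (expLoss D f) (x (k - delay k ω) ω)

/-- `T` is drawn from `{1, …, K}` with `Prob(T = k) = a k / ∑_{j=1}^K a j`, independently of the
iterates. -/
structure IsRandomIndex {n : ℕ} {Ω : Type*} [MeasurableSpace Ω] (P : MeasureTheory.Measure Ω)
    (a : ℕ → ℝ) (K : ℕ) (x : ℕ → Ω → Vec n) (T : Ω → ℕ) : Prop where
  measurable : Measurable T
  law : ∀ k ∈ Finset.Icc 1 K, P.real {ω | T ω = k} = a k / ∑ j ∈ Finset.Icc 1 K, a j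
  indep : ProbabilityTheory.IndepFun T (fun ω (k : Fin (K + 1)) => x k ω) P

end InertialSGM

open InertialSGM

/-!
The prox-point `p(x)` of `φ` at `x` is also a prox-point of `r`, so nonexpansiveness of `prox_{ar}`
bounds the distance from the next iterate to `p(x)` by the norm of `drift - a e`, where the drift
is known before the sample is drawn and `e` is the sampling error. Since `e` is orthogonal to the
drift, one step decreases `E φ_{1/ρbar}` by a multiple of `E‖∇φ_{1/ρbar}‖²`, up to the variance of
`e` and to squared displacements caused by inertia and delay. The displacements are summable
because the objective itself decreases along every path, up to squared errors, at rate `γ̃`.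
-/

namespace InertialSGM

open Filter Topology MeasureTheory ProbabilityTheory
open scoped InnerProductSpace

/-! ### Extended-valued functions and composite objectives -/

section Objective

variable {n : ℕ} {r h : Vec n → EReal} {F G : Vec n → ℝ} {ρ : ℝ} {S : Set (Vec n)} {x y : Vec n}

theorem mem_effDom : x ∈ effDom h ↔ h x < ⊤ := Iff.rfl

theorem notMem_effDom : x ∉ effDom h ↔ h x = ⊤ := by
  rw [mem_effDom, not_lt_top_iff]

theorem coe_optVal_le (hh : (⨅ x, h x) ≠ ⊥) (y : Vec n) : (optVal h : EReal) ≤ h y :=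
  (EReal.coe_toReal_le hh).trans (iInf_le h y)

theorem optVal_le_toReal (hh : (⨅ x, h x) ≠ ⊥) (hy : y ∈ effDom h) :
    optVal h ≤ (h y).toReal :=
  EReal.toReal_le_toReal (iInf_le h y) hh hy.ne

theorem effDom_objective (F : Vec n → ℝ) (r : Vec n → EReal) :
    effDom (objective F r) = effDom r := by
  ext x
  simp [mem_effDom, objective, lt_top_iff_ne_top, EReal.add_ne_top_iff_ne_top_right]

theorem objective_zero (r : Vec n → EReal) : objective (fun _ => 0) r = r := by
  ext x
  simp [objective]

theorem ProperClosedConvex.coe_toReal (hr : ProperClosedConvex r) (hx : x ∈ effDom r) :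
    ((r x).toReal : EReal) = r x :=
  EReal.coe_toReal hx.ne (hr.ne_bot x)

theorem ProperClosedConvex.coe_objective (hr : ProperClosedConvex r) (hx : x ∈ effDom r) :
    ((F x + (r x).toReal : ℝ) : EReal) = objective F r x := by
  rw [EReal.coe_add, hr.coe_toReal hx, objective]

theorem ProperClosedConvex.toReal_objective (hr : ProperClosedConvex r) (hx : x ∈ effDom r) :
    (objective F r x).toReal = F x + (r x).toReal := by
  rw [← hr.coe_objective hx, EReal.toReal_coe]

theorem ProperClosedConvex.convexOn (hr : ProperClosedConvex r) :
    ConvexOn ℝ (effDom r) (fun x => (r x).toReal) := by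
  have jensen : ∀ x ∈ effDom r, ∀ y ∈ effDom r, ∀ s t : ℝ, 0 ≤ s → 0 ≤ t → s + t = 1 →
      r (s • x + t • y) ≤ ((s * (r x).toReal + t * (r y).toReal : ℝ) : EReal) := by
    intro x hx y hy s t hs ht hst
    have h := hr.convex_epi (x := (x, (r x).toReal)) (y := (y, (r y).toReal))
      (by simp [hr.coe_toReal hx]) (by simp [hr.coe_toReal hy]) hs ht hst
    simpa using h
  have dom_convex : Convex ℝ (effDom r) := fun x hx y hy s t hs ht hst =>
    (jensen x hx y hy s t hs ht hst).trans_lt (EReal.coe_lt_top _)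
  refine ⟨dom_convex, fun x hx y hy s t hs ht hst => ?_⟩
  have h := jensen x hx y hy s t hs ht hst
  rw [← hr.coe_toReal (dom_convex hx hy hs ht hst)] at h
  simpa using EReal.coe_le_coe_iff.1 h

theorem SmoothIn.neg (hF : SmoothIn ρ F S) : SmoothIn ρ (fun x => -F x) S := by
  have gradient_neg (x : Vec n) : gradient (fun y => -F y) x = -gradient F x := by
    simp [gradient]
  refine ⟨fun x hx => (hF.differentiableAt x hx).neg, fun x hx y hy => ?_⟩
  rw [gradient_neg, gradient_neg, neg_sub_neg, norm_sub_rev]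
  exact hF.lipschitz x hx y hy

theorem smoothIn_zero (S : Set (Vec n)) : SmoothIn 0 (fun _ => 0) S :=
  ⟨fun _ _ => differentiableAt_const _, fun _ _ _ _ => by simp⟩

theorem SmoothIn.le_add_inner (hS : Convex ℝ S) (hF : SmoothIn ρ F S) (hx : x ∈ S) (hy : y ∈ S) :
    F y ≤ F x + ⟪gradient F x, y - x⟫_ℝ + ρ / 2 * ‖y - x‖ ^ 2 := by
  set H : ℝ → ℝ := fun t => F (x + t • (y - x)) - t * ⟪gradient F x, y - x⟫_ℝ
    - t ^ 2 * (ρ / 2 * ‖y - x‖ ^ 2) with hH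
  have segment_mem : ∀ t ∈ Set.Icc (0 : ℝ) 1, x + t • (y - x) ∈ S := fun t ht =>
    hS.add_smul_sub_mem hx hy ht
  have hasDerivAt_H : ∀ t ∈ Set.Icc (0 : ℝ) 1, HasDerivAt H
      (⟪gradient F (x + t • (y - x)), y - x⟫_ℝ - 1 * ⟪gradient F x, y - x⟫_ℝ
        - (2 : ℕ) * t ^ (2 - 1) * (ρ / 2 * ‖y - x‖ ^ 2)) t := by
    intro t ht
    have hline : HasDerivAt (fun t : ℝ => x + t • (y - x)) (y - x) t := by
      simpa using ((hasDerivAt_id t).smul_const (y - x)).const_add x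
    have hcomp := (hF.differentiableAt _ (segment_mem t ht)).hasGradientAt.hasFDerivAt
      |>.comp_hasDerivAt t hline
    simp only [InnerProductSpace.toDual_apply_apply] at hcomp
    exact (hcomp.sub ((hasDerivAt_id t).mul_const _)).sub ((hasDerivAt_pow 2 t).mul_const _)
  have antitone_H : AntitoneOn H (Set.Icc 0 1) := by
    refine antitoneOn_of_deriv_nonpos (convex_Icc 0 1)
      (fun t ht => (hasDerivAt_H t ht).continuousAt.continuousWithinAt)
      (fun t ht => (hasDerivAt_H t (interior_subset ht)).differentiableAt.differentiableWithinAt)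
      fun t ht => ?_
    replace ht := interior_subset ht
    have hlip := hF.lipschitz _ (segment_mem t ht) _ hx
    rw [add_sub_cancel_left, norm_smul, Real.norm_of_nonneg ht.1] at hlip
    have hinner := (real_inner_le_norm (gradient F (x + t • (y - x)) - gradient F x) (y - x)).trans
      (mul_le_mul_of_nonneg_right hlip (norm_nonneg _))
    rw [inner_sub_left] at hinner
    rw [(hasDerivAt_H t ht).deriv]
    push_cast
    linarith
  have h := antitone_H (Set.left_mem_Icc.2 zero_le_one) (Set.right_mem_Icc.2 zero_le_one)
    zero_le_one
  simp only [hH, one_smul, zero_smul, add_zero, add_sub_cancel] at h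
  linarith

theorem SmoothIn.add_inner_sub_le (hS : Convex ℝ S) (hF : SmoothIn ρ F S) (hx : x ∈ S)
    (hy : y ∈ S) : F x + ⟪gradient F x, y - x⟫_ℝ - ρ / 2 * ‖y - x‖ ^ 2 ≤ F y := by
  have h := hF.neg.le_add_inner hS hx hy
  simp only [gradient, fderiv_fun_neg, map_neg, inner_neg_left] at h ⊢
  linarith

theorem lowerSemicontinuousAt_objective (hF : ContinuousAt F y)
    (hr : LowerSemicontinuousAt r y) : LowerSemicontinuousAt (objective F r) y :=
  (continuous_coe_real_ereal.continuousAt.comp hF).lowerSemicontinuousAt.add' hr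
    (EReal.continuousAt_add (Or.inl (EReal.coe_ne_top _)) (Or.inl (EReal.coe_ne_bot _)))

theorem objective_le_objective (hFG : ∀ x ∈ effDom r, F x ≤ G x) (x : Vec n) :
    objective F r x ≤ objective G r x := by
  by_cases hx : x ∈ effDom r
  · exact add_le_add_left (EReal.coe_le_coe_iff.2 (hFG x hx)) _
  · simp [objective, notMem_effDom.1 hx]

-- `F` is arbitrary off `dom r`; there, `φ` is bounded below by `q + r` for a concave quadratic `q`
-- minorizing `F` on `dom r`.
theorem ProperClosedConvex.lowerSemicontinuous_objective (hr : ProperClosedConvex r)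
    (hF : SmoothIn ρ F (effDom r)) : LowerSemicontinuous (objective F r) := by
  intro y
  by_cases hy : y ∈ effDom r
  · exact lowerSemicontinuousAt_objective (hF.differentiableAt y hy).continuousAt (hr.lsc y)
  · obtain ⟨x₀, hx₀⟩ := hr.nonempty_dom
    set q : Vec n → ℝ := fun z =>
      F x₀ + ⟪gradient F x₀, z - x₀⟫_ℝ - ρ / 2 * ‖z - x₀‖ ^ 2
    have minorant : ∀ z, objective q r z ≤ objective F r z :=
      objective_le_objective fun z hz => hF.add_inner_sub_le hr.convexOn.1 hx₀ hz
    have lsc_minorant : LowerSemicontinuousAt (objective q r) y :=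
      lowerSemicontinuousAt_objective (by fun_prop) (hr.lsc y)
    intro c hc
    have hc' : c < objective q r y := by simpa [objective, notMem_effDom.1 hy] using hc
    filter_upwards [lsc_minorant c hc'] with z hz using hz.trans_le (minorant z)

end Objective

/-! ### Proximal points -/

section FirstOrder

variable {E : Type*} [NormedAddCommGroup E] [InnerProductSpace ℝ E] [CompleteSpace E]

theorem hasGradientAt_add {G H : E → ℝ} {u v p : E} (hG : HasGradientAt G u p)
    (hH : HasGradientAt H v p) : HasGradientAt (fun y => G y + H y) (u + v) p := by
  rw [hasGradientAt_iff_hasFDerivAt, map_add]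
  exact hG.hasFDerivAt.add hH.hasFDerivAt

theorem hasGradientAt_const_mul_norm_sub_sq (c : ℝ) (z p : E) :
    HasGradientAt (fun y => c * ‖y - z‖ ^ 2) ((2 * c) • (p - z)) p := by
  rw [hasGradientAt_iff_hasFDerivAt]
  refine (((hasFDerivAt_id p).sub_const z).norm_sq.const_mul c).congr_fderiv ?_
  ext w
  simp [mul_left_comm, mul_assoc]

theorem le_add_inner_of_forall_add_le {S : Set E} {R G : E → ℝ} {v p y : E}
    (hR : ConvexOn ℝ S R) (hp : p ∈ S) (hG : HasGradientAt G v p)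
    (hmin : ∀ y ∈ S, G p + R p ≤ G y + R y) (hy : y ∈ S) :
    R p ≤ R y + ⟪v, y - p⟫_ℝ := by
  have hline : HasDerivAt (fun t : ℝ => G (p + t • (y - p))) ⟪v, y - p⟫_ℝ 0 := by
    have hpath : HasDerivAt (fun t : ℝ => p + t • (y - p)) (y - p) 0 := by
      simpa using ((hasDerivAt_id (0 : ℝ)).smul_const (y - p)).const_add p
    have hG_at_zero : HasFDerivAt G (InnerProductSpace.toDual ℝ E v) (p + (0 : ℝ) • (y - p)) := by
      simpa using hG.hasFDerivAt
    have hcomp := hG_at_zero.comp_hasDerivAt (0 : ℝ) hpath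
    rwa [InnerProductSpace.toDual_apply_apply] at hcomp
  have slope_ge : ∀ᶠ t : ℝ in 𝓝[>] 0, R p - R y ≤
      t⁻¹ • (G (p + (0 + t) • (y - p)) - G (p + (0 : ℝ) • (y - p))) := by
    filter_upwards [Ioc_mem_nhdsGT one_pos] with t ⟨ht0, ht1⟩
    have hc : p + t • (y - p) = (1 - t) • p + t • y := by module
    have hmem : (1 - t) • p + t • y ∈ S := hR.1 hp hy (by linarith) ht0.le (by ring)
    have hval := hR.2 hp hy (sub_nonneg.2 ht1) ht0.le (by ring)
    simp only [smul_eq_mul] at hval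
    rw [zero_add, zero_smul, add_zero, hc, smul_eq_mul, inv_mul_eq_div, le_div_iff₀ ht0]
    linarith [hmin _ hmem]
  linarith [ge_of_tendsto hline.tendsto_slope_zero_right slope_ge]

end FirstOrder

theorem exists_forall_le_of_isCompact {X : Type*} [TopologicalSpace X] {Q : X → EReal}
    (hQ : LowerSemicontinuous Q) {s : Set X} (hs : IsCompact s) (x₀ : X)
    (hout : ∀ y ∉ s, Q x₀ ≤ Q y) : ∃ p, ∀ y, Q p ≤ Q y := by
  obtain ⟨p, -, hp⟩ := (hQ.lowerSemicontinuousOn _).exists_isMinOn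
    (Set.insert_nonempty x₀ s) (hs.insert x₀)
  refine ⟨p, fun y => ?_⟩
  by_cases hy : y ∈ s
  · exact hp (Set.mem_insert_of_mem x₀ hy)
  · exact (hp (Set.mem_insert x₀ s)).trans (hout y hy)

section Prox

variable {n : ℕ} {h r : Vec n → EReal} {F : Vec n → ℝ} {ρ t : ℝ} {x x' p p' y v : Vec n}

theorem lowerSemicontinuous_add_norm_sub_sq (hh : LowerSemicontinuous h) (c : ℝ) (x : Vec n) :
    LowerSemicontinuous fun y => h y + ((c * ‖y - x‖ ^ 2 : ℝ) : EReal) := by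
  have hcont : Continuous fun y : Vec n => c * ‖y - x‖ ^ 2 := by fun_prop
  intro y
  have hy : LowerSemicontinuousAt h y := hh y
  exact hy.add' (continuous_coe_real_ereal.comp hcont).continuousAt.lowerSemicontinuousAt
    (EReal.continuousAt_add (Or.inr (EReal.coe_ne_bot _)) (Or.inr (EReal.coe_ne_top _)))

theorem exists_isProx (hh : LowerSemicontinuous h) (hbdd : (⨅ x, h x) ≠ ⊥) (ht : 0 < t)
    (x : Vec n) : ∃ p, IsProx t h x p := by
  by_cases hdom : (effDom h).Nonempty
  · obtain ⟨x₀, hx₀⟩ := hdom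
    set M := (h x₀).toReal + 1 / (2 * t) * ‖x₀ - x‖ ^ 2
    have le_outside : ∀ y ∉ Metric.closedBall x √(2 * t * (M - optVal h)),
        h x₀ + ((1 / (2 * t) * ‖x₀ - x‖ ^ 2 : ℝ) : EReal)
          ≤ h y + ((1 / (2 * t) * ‖y - x‖ ^ 2 : ℝ) : EReal) := by
      intro y hy
      rw [Metric.mem_closedBall, dist_eq_norm, not_le] at hy
      have hsq : 2 * t * (M - optVal h) ≤ ‖y - x‖ ^ 2 :=
        (Real.sqrt_le_left (norm_nonneg _)).1 hy.le
      have hM : M ≤ optVal h + 1 / (2 * t) * ‖y - x‖ ^ 2 := by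
        rw [one_div_mul_eq_div, ← sub_le_iff_le_add', le_div_iff₀' (by positivity)]
        exact hsq
      calc h x₀ + ((1 / (2 * t) * ‖x₀ - x‖ ^ 2 : ℝ) : EReal)
          = M := by
            rw [EReal.coe_add,
              EReal.coe_toReal hx₀.ne (ne_bot_of_le_ne_bot hbdd (iInf_le h x₀))]
        _ ≤ ((optVal h + 1 / (2 * t) * ‖y - x‖ ^ 2 : ℝ) : EReal) := EReal.coe_le_coe_iff.2 hM
        _ = (optVal h : EReal) + ((1 / (2 * t) * ‖y - x‖ ^ 2 : ℝ) : EReal) := EReal.coe_add _ _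
        _ ≤ h y + ((1 / (2 * t) * ‖y - x‖ ^ 2 : ℝ) : EReal) :=
            add_le_add_left (coe_optVal_le hbdd y) _
    exact exists_forall_le_of_isCompact (lowerSemicontinuous_add_norm_sub_sq hh _ x)
      (isCompact_closedBall _ _) x₀ le_outside
  · have h_top : ∀ y, h y = ⊤ := fun y => notMem_effDom.1 fun hy => hdom ⟨y, hy⟩
    exact ⟨x, fun y => by rw [h_top, h_top, EReal.top_add_coe, EReal.top_add_coe]⟩

theorem IsProx.mem_effDom (hp : IsProx t h x p) (hh : (effDom h).Nonempty) : p ∈ effDom h := by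
  obtain ⟨y, hy⟩ := hh
  by_contra hpd
  have hle := hp y
  rw [notMem_effDom.1 hpd, EReal.top_add_coe] at hle
  exact (EReal.add_lt_top (ne_of_lt hy) (EReal.coe_ne_top _)).not_ge hle

theorem IsProx.mem_effDom_of_objective (hp : IsProx t (objective F r) x p)
    (hr : (effDom r).Nonempty) : p ∈ effDom r := by
  rw [← effDom_objective F r] at hr ⊢
  exact hp.mem_effDom hr

theorem IsProx.toReal_objective_le (hr : ProperClosedConvex r)
    (hp : IsProx t (objective F r) x p) (hy : y ∈ effDom r) :
    F p + (r p).toReal + 1 / (2 * t) * ‖p - x‖ ^ 2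
      ≤ F y + (r y).toReal + 1 / (2 * t) * ‖y - x‖ ^ 2 := by
  have hle := hp y
  rwa [← hr.coe_objective (hp.mem_effDom_of_objective hr.nonempty_dom), ← hr.coe_objective hy,
    ← EReal.coe_add, ← EReal.coe_add, EReal.coe_le_coe_iff] at hle

theorem IsProx.objective_le_add_inner (hr : ProperClosedConvex r)
    (hF : DifferentiableAt ℝ F p) (hp : IsProx t (objective F r) x p) (hy : y ∈ effDom r) :
    (r p).toReal ≤ (r y).toReal + ⟪gradient F p + t⁻¹ • (p - x), y - p⟫_ℝ := by
  have hgrad := hasGradientAt_add hF.hasGradientAt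
    (hasGradientAt_const_mul_norm_sub_sq (1 / (2 * t)) x p)
  rw [show 2 * (1 / (2 * t)) = t⁻¹ by rw [one_div, mul_inv, mul_inv_cancel_left₀ two_ne_zero]]
    at hgrad
  refine le_add_inner_of_forall_add_le hr.convexOn
    (hp.mem_effDom_of_objective hr.nonempty_dom) hgrad (fun z hz => ?_) hy
  linarith [hp.toReal_objective_le hr hz]

theorem IsProx.le_add_inner (hr : ProperClosedConvex r) (hp : IsProx t r x p)
    (hy : y ∈ effDom r) : (r p).toReal ≤ (r y).toReal + ⟪t⁻¹ • (p - x), y - p⟫_ℝ := by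
  rw [← objective_zero r] at hp
  simpa using hp.objective_le_add_inner hr (differentiableAt_const 0) hy

theorem isProx_of_forall_le_add_inner (hr : ProperClosedConvex r) (ht : 0 < t)
    (hp : p ∈ effDom r)
    (hv : ∀ y ∈ effDom r, (r p).toReal ≤ (r y).toReal + ⟪v, y - p⟫_ℝ) :
    IsProx t r (p - t • v) p := by
  intro y
  by_cases hy : y ∈ effDom r
  · rw [← hr.coe_toReal hp, ← hr.coe_toReal hy, ← EReal.coe_add, ← EReal.coe_add,
      EReal.coe_le_coe_iff]
    have expand : 1 / (2 * t) * ‖y - (p - t • v)‖ ^ 2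
        = 1 / (2 * t) * ‖y - p‖ ^ 2 + ⟪v, y - p⟫_ℝ + 1 / (2 * t) * ‖p - (p - t • v)‖ ^ 2 := by
      rw [sub_sub_cancel, ← sub_add, norm_add_sq_real, inner_smul_right, real_inner_comm]
      field_simp
    have : 0 ≤ 1 / (2 * t) * ‖y - p‖ ^ 2 := by positivity
    linarith [hv y hy]
  · rw [notMem_effDom.1 hy, EReal.top_add_coe]
    exact le_top

-- Add the variational inequalities of the two proximal points, each tested at the other point.
theorem IsProx.one_sub_mul_norm_sub_le (hr : ProperClosedConvex r)
    (hF : SmoothIn ρ F (effDom r)) (ht : 0 < t) (hp : IsProx t (objective F r) x p)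
    (hp' : IsProx t (objective F r) x' p') : (1 - t * ρ) * ‖p - p'‖ ≤ ‖x - x'‖ := by
  have hpd := hp.mem_effDom_of_objective hr.nonempty_dom
  have hpd' := hp'.mem_effDom_of_objective hr.nonempty_dom
  have hvi := hp.objective_le_add_inner hr (hF.differentiableAt p hpd) hpd'
  have hvi' := hp'.objective_le_add_inner hr (hF.differentiableAt p' hpd') hpd
  have hsum : ‖p - p'‖ ^ 2
      ≤ t * ⟪gradient F p' - gradient F p, p - p'⟫_ℝ + ⟪x - x', p - p'⟫_ℝ := by
    have expand : t * (⟪gradient F p + t⁻¹ • (p - x), p' - p⟫_ℝ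
          + ⟪gradient F p' + t⁻¹ • (p' - x'), p - p'⟫_ℝ)
        = t * ⟪gradient F p' - gradient F p, p - p'⟫_ℝ + ⟪x - x', p - p'⟫_ℝ
          - ‖p - p'‖ ^ 2 := by
      rw [← real_inner_self_eq_norm_sq, ← neg_sub p p', inner_neg_right]
      simp only [inner_add_left, inner_sub_left, real_inner_smul_left]
      field_simp
      ring
    nlinarith
  have hlip := hF.lipschitz p' hpd' p hpd
  rw [norm_sub_rev p' p] at hlip
  have hG : ⟪gradient F p' - gradient F p, p - p'⟫_ℝ ≤ ρ * ‖p - p'‖ * ‖p - p'‖ :=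
    (real_inner_le_norm _ _).trans (mul_le_mul_of_nonneg_right hlip (norm_nonneg _))
  have hx := real_inner_le_norm (x - x') (p - p')
  rcases (norm_nonneg (p - p')).eq_or_lt with h0 | h0
  · simp [← h0]
  · exact le_of_mul_le_mul_right (by nlinarith) h0

theorem IsProx.norm_sub_le (hr : ProperClosedConvex r) (ht : 0 < t) (hp : IsProx t r x p)
    (hp' : IsProx t r x' p') : ‖p - p'‖ ≤ ‖x - x'‖ := by
  rw [← objective_zero r] at hp hp'
  simpa using hp.one_sub_mul_norm_sub_le hr (smoothIn_zero _) ht hp'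

/-- The proximal point `prox_{t h}(x)`; an arbitrary point if `h + ‖· - x‖² / (2t)` has no
minimizer. -/
noncomputable def prox (t : ℝ) (h : Vec n → EReal) (x : Vec n) : Vec n :=
  Classical.epsilon (IsProx t h x)

theorem isProx_prox (hx : ∃ p, IsProx t h x p) : IsProx t h x (prox t h x) :=
  Classical.epsilon_spec hx

theorem IsProx.eq_prox (hr : ProperClosedConvex r) (ht : 0 < t) (hp : IsProx t r x p) :
    p = prox t r x := by
  simpa [sub_eq_zero] using hp.norm_sub_le hr ht (isProx_prox ⟨p, hp⟩)

theorem lipschitzOnWith_prox (hr : ProperClosedConvex r) (ht : 0 < t) :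
    LipschitzOnWith 1 (prox t r) {z | ∃ p, IsProx t r z p} :=
  LipschitzOnWith.of_dist_le_mul fun z hz z' hz' => by
    simpa [dist_eq_norm] using (isProx_prox hz).norm_sub_le hr ht (isProx_prox hz')

theorem isProx_prox_objective (hr : ProperClosedConvex r) (hF : SmoothIn ρ F (effDom r))
    (hbdd : (⨅ x, objective F r x) ≠ ⊥) (ht : 0 < t) (x : Vec n) :
    IsProx t (objective F r) x (prox t (objective F r) x) :=
  isProx_prox (exists_isProx (hr.lowerSemicontinuous_objective hF) hbdd ht x)

theorem lipschitzWith_prox_objective (hr : ProperClosedConvex r) (hF : SmoothIn ρ F (effDom r))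
    (hbdd : (⨅ x, objective F r x) ≠ ⊥) (ht : 0 < t) (htρ : t * ρ < 1) :
    LipschitzWith (1 - t * ρ)⁻¹.toNNReal (prox t (objective F r)) := by
  refine LipschitzWith.of_dist_le_mul fun x x' => ?_
  have h := (isProx_prox_objective hr hF hbdd ht x).one_sub_mul_norm_sub_le hr hF ht
    (isProx_prox_objective hr hF hbdd ht x')
  rwa [Real.coe_toNNReal _ (inv_nonneg.2 (sub_nonneg.2 htρ.le)), dist_eq_norm, dist_eq_norm,
    inv_mul_eq_div, le_div_iff₀' (sub_pos.2 htρ)]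

end Prox

/-! ### Moreau envelopes -/

theorem hasGradientAt_of_sub_le_inner_add_sq {E : Type*} [NormedAddCommGroup E]
    [InnerProductSpace ℝ E] [CompleteSpace E] {M : E → ℝ} {G : E → E} {L : NNReal} {C : ℝ}
    (hG : LipschitzWith L G) (hM : ∀ x y, M y - M x ≤ ⟪G x, y - x⟫_ℝ + C * ‖y - x‖ ^ 2) (x : E) :
    HasGradientAt M (G x) x := by
  rw [hasGradientAt_iff_isLittleO]
  refine Asymptotics.IsBigO.trans_isLittleO (g := fun y => ‖y - x‖ ^ 2) ?_
    (Asymptotics.isLittleO_pow_sub_sub x one_lt_two)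
  refine Asymptotics.IsBigO.of_bound (L + C) (Eventually.of_forall fun y => ?_)
  have upper := hM x y
  have lower := hM y x
  have hlip : ⟪G x - G y, y - x⟫_ℝ ≤ L * ‖y - x‖ ^ 2 := by
    have h := hG.norm_sub_le x y
    rw [norm_sub_rev x y] at h
    calc ⟪G x - G y, y - x⟫_ℝ ≤ ‖G x - G y‖ * ‖y - x‖ := real_inner_le_norm _ _
      _ ≤ L * ‖y - x‖ * ‖y - x‖ := mul_le_mul_of_nonneg_right h (norm_nonneg _)
      _ = L * ‖y - x‖ ^ 2 := by ring
  rw [← neg_sub y x, inner_neg_right, norm_neg] at lower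
  rw [inner_sub_left] at hlip
  have hL : 0 ≤ L * ‖y - x‖ ^ 2 := by positivity
  rw [Real.norm_eq_abs, norm_pow, norm_norm, abs_le]
  constructor <;> linarith

section Moreau

variable {n : ℕ} {r : Vec n → EReal} {F : Vec n → ℝ} {ρ t : ℝ} {x y p : Vec n}

theorem IsProx.moreau_eq (hr : ProperClosedConvex r) (hp : IsProx t (objective F r) x p) :
    moreau t (objective F r) x = F p + (r p).toReal + 1 / (2 * t) * ‖p - x‖ ^ 2 := by
  have h : (⨅ y, objective F r y + ((1 / (2 * t) * ‖y - x‖ ^ 2 : ℝ) : EReal))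
      = objective F r p + ((1 / (2 * t) * ‖p - x‖ ^ 2 : ℝ) : EReal) :=
    le_antisymm (iInf_le _ p) (le_iInf hp)
  rw [moreau, h, ← hr.coe_objective (hp.mem_effDom_of_objective hr.nonempty_dom),
    ← EReal.coe_add, EReal.toReal_coe]

theorem IsProx.moreau_le (hr : ProperClosedConvex r) (hp : IsProx t (objective F r) x p)
    (hy : y ∈ effDom r) :
    moreau t (objective F r) x ≤ F y + (r y).toReal + 1 / (2 * t) * ‖y - x‖ ^ 2 := by
  rw [hp.moreau_eq hr]
  exact hp.toReal_objective_le hr hy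

theorem IsProx.optVal_le_moreau (hr : ProperClosedConvex r)
    (hbdd : (⨅ x, objective F r x) ≠ ⊥) (ht : 0 < t) (hp : IsProx t (objective F r) x p) :
    optVal (objective F r) ≤ moreau t (objective F r) x := by
  have hpd := hp.mem_effDom_of_objective hr.nonempty_dom
  have h := optVal_le_toReal hbdd ((effDom_objective F r).symm ▸ hpd)
  rw [hp.moreau_eq hr, ← hr.toReal_objective hpd]
  exact h.trans (le_add_of_nonneg_right (by positivity))

theorem hasGradientAt_moreau (hr : ProperClosedConvex r) (hF : SmoothIn ρ F (effDom r))
    (hbdd : (⨅ x, objective F r x) ≠ ⊥) (ht : 0 < t) (htρ : t * ρ < 1) (x : Vec n) :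
    HasGradientAt (moreau t (objective F r)) (t⁻¹ • (x - prox t (objective F r) x)) x := by
  have hlip := (lipschitzWith_smul (β := Vec n) t⁻¹).comp
    (LipschitzWith.id.sub (lipschitzWith_prox_objective hr hF hbdd ht htρ))
  refine hasGradientAt_of_sub_le_inner_add_sq (C := 1 / (2 * t)) hlip (fun x y => ?_) x
  have hpx := isProx_prox_objective hr hF hbdd ht x
  have hle := (isProx_prox_objective hr hF hbdd ht y).moreau_le hr
    (hpx.mem_effDom_of_objective hr.nonempty_dom)
  simp only [Function.comp_apply, id]
  rw [hpx.moreau_eq hr]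
  generalize prox t (objective F r) x = p at hle ⊢
  have expand : 1 / (2 * t) * ‖p - y‖ ^ 2
      = 1 / (2 * t) * ‖p - x‖ ^ 2 + ⟪t⁻¹ • (x - p), y - x⟫_ℝ + 1 / (2 * t) * ‖y - x‖ ^ 2 := by
    rw [← sub_sub_sub_cancel_right p y x, norm_sub_sq_real, real_inner_smul_left, ← neg_sub p x,
      inner_neg_left]
    field_simp
    ring
  linarith

theorem norm_gradient_moreau_sq (hr : ProperClosedConvex r) (hF : SmoothIn ρ F (effDom r))
    (hbdd : (⨅ x, objective F r x) ≠ ⊥) (ht : 0 < t) (htρ : t * ρ < 1) (x : Vec n) :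
    ‖gradient (moreau t (objective F r)) x‖ ^ 2
      = t⁻¹ ^ 2 * ‖x - prox t (objective F r) x‖ ^ 2 := by
  rw [(hasGradientAt_moreau hr hF hbdd ht htρ x).gradient, norm_smul, mul_pow, Real.norm_eq_abs,
    sq_abs]

end Moreau

/-! ### One step of the method -/

theorem real_inner_le_mul_sq_add_sq {E : Type*} [NormedAddCommGroup E] [InnerProductSpace ℝ E]
    {c : ℝ} (hc : 0 < c) (u v : E) : ⟪u, v⟫_ℝ ≤ c * ‖u‖ ^ 2 + ‖v‖ ^ 2 / (4 * c) := by
  have h : 0 ≤ ‖(2 * c) • u - v‖ ^ 2 / (4 * c) := by positivity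
  rw [norm_sub_sq_real, norm_smul, real_inner_smul_left, Real.norm_of_nonneg (by positivity)] at h
  have expand : ((2 * c * ‖u‖) ^ 2 - 2 * (2 * c * ⟪u, v⟫_ℝ) + ‖v‖ ^ 2) / (4 * c)
      = c * ‖u‖ ^ 2 + ‖v‖ ^ 2 / (4 * c) - ⟪u, v⟫_ℝ := by
    field_simp
    ring
  linarith

theorem sq_add_add_le {s D p q : ℝ} (hs : 0 < s) (hs1 : s ≤ 1) :
    ((1 - s) * D + p + q) ^ 2
      ≤ (1 - s / 4) * D ^ 2 + (4 + 8 / s) * q ^ 2 + (1 + 1 / s) * p ^ 2 := by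
  obtain ⟨p, rfl⟩ : ∃ p', p = s * p' := ⟨p / s, by field_simp⟩
  obtain ⟨q, rfl⟩ : ∃ q', q = s * q' := ⟨q / s, by field_simp⟩
  have : 0 ≤ 1 - s := sub_nonneg.2 hs1
  have slack : 0 ≤ 5 / 4 * ((1 - s) * s) * (D - 4 / 5 * p) ^ 2
      + 1 / 2 * ((1 - s) * s) * (D - 2 * q) ^ 2 + 1 / 5 * s * (p - 5 * s * q) ^ 2
      + 3 / 4 * s ^ 2 * D ^ 2 + 4 / 5 * s ^ 2 * p ^ 2 + 6 * s * q ^ 2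
      + 5 * (1 - s) * s ^ 2 * q ^ 2 := by positivity
  have cancel : (1 - s / 4) * D ^ 2 + (4 + 8 / s) * (s * q) ^ 2 + (1 + 1 / s) * (s * p) ^ 2
      = (1 - s / 4) * D ^ 2 + (4 * s ^ 2 + 8 * s) * q ^ 2 + (s ^ 2 + s) * p ^ 2 := by
    field_simp
  linarith

section Step

variable {n : ℕ} {r : Vec n → EReal} {F : Vec n → ℝ} {S : Set (Vec n)} {ρ ρbar a b : ℝ}
  {x xprev xnext y e g : Vec n}

theorem SmoothIn.norm_gradient_sub_sq_le (hF : SmoothIn ρ F S) (hx : x ∈ S) (hy : y ∈ S) :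
    ‖gradient F x - gradient F y‖ ^ 2 ≤ ρ ^ 2 * ‖x - y‖ ^ 2 := by
  rw [← mul_pow]
  exact pow_le_pow_left₀ (norm_nonneg _) (hF.lipschitz x hx y hy) 2

theorem IsProx.mul_objective_sub_le (hr : ProperClosedConvex r) (hF : SmoothIn ρ F (effDom r))
    (ha : 0 < a) (hx : x ∈ effDom r)
    (hstep : IsProx a r (x - a • g + b • (x - xprev)) xnext) :
    a * ((objective F r xnext).toReal - (objective F r x).toReal)
      ≤ -(1 - a * ρ / 2) * ‖xnext - x‖ ^ 2 + a * ⟪gradient F x - g, xnext - x⟫_ℝ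
        + b * ⟪x - xprev, xnext - x⟫_ℝ := by
  have hnext : xnext ∈ effDom r := hstep.mem_effDom ⟨x, hx⟩
  have hprox := mul_le_mul_of_nonneg_left (hstep.le_add_inner hr hx) ha.le
  have hdescent := mul_le_mul_of_nonneg_left (hF.le_add_inner hr.convexOn.1 hx hnext) ha.le
  rw [hr.toReal_objective hx, hr.toReal_objective hnext]
  have expand : a * ⟪a⁻¹ • (xnext - (x - a • g + b • (x - xprev))), x - xnext⟫_ℝ
      = -‖xnext - x‖ ^ 2 - a * ⟪g, xnext - x⟫_ℝ + b * ⟪x - xprev, xnext - x⟫_ℝ := by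
    rw [real_inner_smul_left, mul_inv_cancel_left₀ ha.ne', ← neg_sub xnext x, inner_neg_right,
      show xnext - (x - a • g + b • (x - xprev)) = xnext - x + a • g - b • (x - xprev) by abel,
      ← real_inner_self_eq_norm_sq]
    simp only [inner_add_left, inner_sub_left, real_inner_smul_left]
    ring
  rw [mul_add, expand] at hprox
  rw [inner_sub_left]
  linarith

theorem IsProx.mul_objective_sub_le_sq (hr : ProperClosedConvex r)
    (hF : SmoothIn ρ F (effDom r)) (ha : 0 < a) (hb : 0 ≤ b) (hx : x ∈ effDom r)
    (hy : y ∈ effDom r)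
    (hstep : IsProx a r (x - a • (gradient F y + e) + b • (x - xprev)) xnext) :
    a * ((objective F r xnext).toReal - (objective F r x).toReal)
      ≤ -(1 / 2 - a * ρ / 2) * ‖xnext - x‖ ^ 2 + a ^ 2 * ρ ^ 2 * ‖x - y‖ ^ 2 + a ^ 2 * ‖e‖ ^ 2
        + b / 2 * (‖xnext - x‖ ^ 2 + ‖x - xprev‖ ^ 2) := by
  have hmain := hstep.mul_objective_sub_le hr hF ha hx
  have hdelay : a * ⟪gradient F x - gradient F y, xnext - x⟫_ℝ
      ≤ a ^ 2 * ρ ^ 2 * ‖x - y‖ ^ 2 + ‖xnext - x‖ ^ 2 / 4 := by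
    have h := real_inner_le_mul_sq_add_sq one_pos (a • (gradient F x - gradient F y)) (xnext - x)
    rw [real_inner_smul_left, norm_smul, mul_pow, Real.norm_eq_abs, sq_abs] at h
    linarith [mul_le_mul_of_nonneg_left (hF.norm_gradient_sub_sq_le hx hy) (sq_nonneg a)]
  have hnoise : -(a * ⟪e, xnext - x⟫_ℝ) ≤ a ^ 2 * ‖e‖ ^ 2 + ‖xnext - x‖ ^ 2 / 4 := by
    have h := real_inner_le_mul_sq_add_sq one_pos ((-a) • e) (xnext - x)
    rw [real_inner_smul_left, norm_smul, mul_pow, Real.norm_eq_abs, sq_abs] at h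
    linarith
  have hinertia : b * ⟪x - xprev, xnext - x⟫_ℝ
      ≤ b / 2 * (‖xnext - x‖ ^ 2 + ‖x - xprev‖ ^ 2) := by
    have h := real_inner_le_mul_sq_add_sq one_half_pos (x - xprev) (xnext - x)
    linarith [mul_le_mul_of_nonneg_left h hb]
  rw [← sub_sub, inner_sub_left _ e] at hmain
  linarith

/-- The noise-free displacement of an inertial step from `x` relative to its proximal point
`p = prox_{φ/ρbar}(x)`, where the gradient is evaluated at the delayed point `y`: nonexpansiveness
of `prox_{a r}` bounds `‖xnext - p‖` by `‖drift - a e‖` if the sample gradient is `∇F y + e`. -/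
noncomputable def drift (F : Vec n → ℝ) (r : Vec n → EReal) (ρbar a b : ℝ) (x xprev y : Vec n) :
    Vec n :=
  (1 - a * ρbar) • (x - prox (1 / ρbar) (objective F r) x)
    - a • (gradient F y - gradient F (prox (1 / ρbar) (objective F r) x)) + b • (x - xprev)

theorem prox_objective_mem_effDom (hr : ProperClosedConvex r) (hF : SmoothIn ρ F (effDom r))
    (hbdd : (⨅ x, objective F r x) ≠ ⊥) {t : ℝ} (ht : 0 < t) (x : Vec n) :
    prox t (objective F r) x ∈ effDom r :=
  (isProx_prox_objective hr hF hbdd ht x).mem_effDom_of_objective hr.nonempty_dom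

-- `p` is itself a `prox_{a r}` point, namely that of `p - a (∇F p + ρbar (p - x))`.
theorem IsProx.norm_sub_prox_le (hr : ProperClosedConvex r) (hF : SmoothIn ρ F (effDom r))
    (hbdd : (⨅ x, objective F r x) ≠ ⊥) (hρbar : 0 < ρbar) (ha : 0 < a)
    (hstep : IsProx a r (x - a • (gradient F y + e) + b • (x - xprev)) xnext) :
    ‖xnext - prox (1 / ρbar) (objective F r) x‖ ≤ ‖drift F r ρbar a b x xprev y - a • e‖ := by
  have hp := isProx_prox_objective hr hF hbdd (one_div_pos.2 hρbar) x
  have hpd := prox_objective_mem_effDom hr hF hbdd (one_div_pos.2 hρbar) x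
  rw [drift]
  generalize prox (1 / ρbar) (objective F r) x = p at hp hpd ⊢
  have fixed : IsProx a r (p - a • (gradient F p + ρbar • (p - x))) p :=
    isProx_of_forall_le_add_inner hr ha hpd fun z hz => by
      simpa using hp.objective_le_add_inner hr (hF.differentiableAt p hpd) hz
  refine (hstep.norm_sub_le hr ha fixed).trans_eq (congrArg norm ?_)
  module

theorem norm_drift_le (hr : ProperClosedConvex r) (hF : SmoothIn ρ F (effDom r))
    (hbdd : (⨅ x, objective F r x) ≠ ⊥) (hρbar : 0 < ρbar) (ha : 0 < a) (hb : 0 ≤ b)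
    (haρ : a * ρbar ≤ 1) (hx : x ∈ effDom r) (hy : y ∈ effDom r) :
    ‖drift F r ρbar a b x xprev y‖
      ≤ (1 - a * (ρbar - ρ)) * ‖x - prox (1 / ρbar) (objective F r) x‖ + a * (ρ * ‖x - y‖)
        + b * ‖x - xprev‖ := by
  have hpd := prox_objective_mem_effDom hr hF hbdd (one_div_pos.2 hρbar) x
  rw [drift]
  generalize prox (1 / ρbar) (objective F r) x = p at hpd ⊢
  have split : (1 - a * ρbar) • (x - p) - a • (gradient F y - gradient F p) + b • (x - xprev)
      = (1 - a * ρbar) • (x - p) + a • (gradient F p - gradient F x)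
        + a • (gradient F x - gradient F y) + b • (x - xprev) := by module
  rw [split]
  refine norm_add₄_le.trans ?_
  simp only [norm_smul, Real.norm_of_nonneg ha.le, Real.norm_of_nonneg hb,
    Real.norm_of_nonneg (sub_nonneg.2 haρ)]
  have hxp := mul_le_mul_of_nonneg_left (hF.lipschitz p hpd x hx) ha.le
  have hxy := mul_le_mul_of_nonneg_left (hF.lipschitz x hx y hy) ha.le
  rw [norm_sub_rev p x] at hxp
  linarith

theorem norm_drift_sq_le (hr : ProperClosedConvex r) (hF : SmoothIn ρ F (effDom r))
    (hbdd : (⨅ x, objective F r x) ≠ ⊥) (hρ : 0 ≤ ρ) (hρbar : ρ < ρbar) (ha : 0 < a) (hb : 0 ≤ b)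
    (haρ : a * ρbar ≤ 1) (hx : x ∈ effDom r) (hy : y ∈ effDom r) :
    ‖drift F r ρbar a b x xprev y‖ ^ 2
      ≤ (1 - a * (ρbar - ρ) / 4) * ‖x - prox (1 / ρbar) (objective F r) x‖ ^ 2
        + 2 * (2 + 4 / (a * (ρbar - ρ))) * b ^ 2 * ‖x - xprev‖ ^ 2
        + ρ ^ 2 * (a ^ 2 + a / (ρbar - ρ)) * ‖x - y‖ ^ 2 := by
  have hδ : 0 < ρbar - ρ := sub_pos.2 hρbar
  have hs : a * (ρbar - ρ) ≤ 1 := by linarith [mul_nonneg ha.le hρ]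
  calc ‖drift F r ρbar a b x xprev y‖ ^ 2
      ≤ ((1 - a * (ρbar - ρ)) * ‖x - prox (1 / ρbar) (objective F r) x‖ + a * (ρ * ‖x - y‖)
        + b * ‖x - xprev‖) ^ 2 := pow_le_pow_left₀ (norm_nonneg _)
          (norm_drift_le hr hF hbdd (hρ.trans_lt hρbar) ha hb haρ hx hy) 2
    _ ≤ _ := sq_add_add_le (mul_pos ha hδ) hs
    _ = _ := by
      field_simp
      ring

theorem IsProx.moreau_le_sub (hr : ProperClosedConvex r) (hF : SmoothIn ρ F (effDom r))
    (hbdd : (⨅ x, objective F r x) ≠ ⊥) (hρ : 0 ≤ ρ) (hρbar : ρ < ρbar) (ha : 0 < a) (hb : 0 ≤ b)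
    (haρ : a * ρbar ≤ 1) (hx : x ∈ effDom r) (hy : y ∈ effDom r)
    (hstep : IsProx a r (x - a • (gradient F y + e) + b • (x - xprev)) xnext) :
    moreau (1 / ρbar) (objective F r) xnext ≤ moreau (1 / ρbar) (objective F r) x
      - a * (ρbar - ρ) * ρbar / 8 * ‖x - prox (1 / ρbar) (objective F r) x‖ ^ 2
      + ρbar * (2 + 4 / (a * (ρbar - ρ))) * b ^ 2 * ‖x - xprev‖ ^ 2
      + ρbar * ρ ^ 2 / 2 * (a ^ 2 + a / (ρbar - ρ)) * ‖x - y‖ ^ 2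
      + ρbar / 2 * a ^ 2 * ‖e‖ ^ 2 - ρbar * a * ⟪drift F r ρbar a b x xprev y, e⟫_ℝ := by
  have hpos : 0 < ρbar := hρ.trans_lt hρbar
  have ht : 0 < 1 / ρbar := one_div_pos.2 hpos
  have hmoreau := (isProx_prox_objective hr hF hbdd ht xnext).moreau_le hr
    (prox_objective_mem_effDom hr hF hbdd ht x)
  have hdrift := norm_drift_sq_le (xprev := xprev) hr hF hbdd hρ hρbar ha hb haρ hx hy
  have hdist := hstep.norm_sub_prox_le hr hF hbdd hpos ha
  rw [(isProx_prox_objective hr hF hbdd ht x).moreau_eq hr]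
  rw [norm_sub_rev, show 1 / (2 * (1 / ρbar)) = ρbar / 2 by field_simp] at hmoreau ⊢
  set p := prox (1 / ρbar) (objective F r) x
  set u := drift F r ρbar a b x xprev y
  have hsq : ‖xnext - p‖ ^ 2 ≤ ‖u‖ ^ 2 - 2 * a * ⟪u, e⟫_ℝ + a ^ 2 * ‖e‖ ^ 2 := by
    refine (pow_le_pow_left₀ (norm_nonneg _) hdist 2).trans_eq ?_
    rw [norm_sub_sq_real, inner_smul_right, norm_smul, mul_pow, Real.norm_eq_abs, sq_abs]
    ring
  have hscaled := mul_le_mul_of_nonneg_left (hsq.trans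
    (add_le_add_left (sub_le_sub_right hdrift _) _)) (half_pos hpos).le
  linarith

end Step

/-! ### Sums of delayed displacements -/

section Delay

variable {E : Type*} [SeminormedAddCommGroup E]

theorem norm_sub_delay_sq_le (x : ℕ → E) (k : ℕ) {j τ : ℕ} (hj : j ≤ τ) :
    ‖x k - x (k - j)‖ ^ 2 ≤ τ * ∑ i ∈ Finset.Ico (k - τ) k, ‖x (i + 1) - x i‖ ^ 2 := by
  have hcard : ((Finset.Ico (k - τ) k).card : ℝ) ≤ τ := by
    rw [Nat.card_Ico]
    exact_mod_cast (by omega : k - (k - τ) ≤ τ)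
  have htriangle : ‖x k - x (k - j)‖ ≤ ∑ i ∈ Finset.Ico (k - τ) k, ‖x (i + 1) - x i‖ := by
    rw [← Finset.sum_Ico_sub x (Nat.sub_le k j)]
    exact (norm_sum_le _ _).trans (Finset.sum_le_sum_of_subset_of_nonneg
      (Finset.Ico_subset_Ico (Nat.sub_le_sub_left hj k) le_rfl) fun _ _ _ => norm_nonneg _)
  calc ‖x k - x (k - j)‖ ^ 2 ≤ (∑ i ∈ Finset.Ico (k - τ) k, ‖x (i + 1) - x i‖) ^ 2 :=
        pow_le_pow_left₀ (norm_nonneg _) htriangle 2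
    _ ≤ (Finset.Ico (k - τ) k).card * ∑ i ∈ Finset.Ico (k - τ) k, ‖x (i + 1) - x i‖ ^ 2 :=
        sq_sum_le_card_mul_sum_sq
    _ ≤ τ * ∑ i ∈ Finset.Ico (k - τ) k, ‖x (i + 1) - x i‖ ^ 2 := by gcongr

-- Double counting: each `j` lies in `[k - τ, k)` for at most `τ` values of `k`.
theorem sum_sum_Ico_sub_le {d : ℕ → ℝ} (hd : ∀ j, 0 ≤ d j) (K τ : ℕ) :
    ∑ k ∈ Finset.Icc 1 K, ∑ j ∈ Finset.Ico (k - τ) k, d j ≤ τ * ∑ j ∈ Finset.range K, d j := by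
  calc ∑ k ∈ Finset.Icc 1 K, ∑ j ∈ Finset.Ico (k - τ) k, d j
      = ∑ j ∈ Finset.range K, ∑ k ∈ Finset.Icc 1 K with j ∈ Finset.Ico (k - τ) k, d j := by
        refine Finset.sum_comm' fun k j => ?_
        simp only [Finset.mem_Icc, Finset.mem_Ico, Finset.mem_filter, Finset.mem_range]
        omega
    _ ≤ ∑ j ∈ Finset.range K, ∑ _k ∈ Finset.Ioc j (j + τ), d j := by
        refine Finset.sum_le_sum fun j _ =>
          Finset.sum_le_sum_of_subset_of_nonneg (fun k => ?_) fun _ _ _ => hd j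
        simp only [Finset.mem_Icc, Finset.mem_Ico, Finset.mem_filter, Finset.mem_Ioc]
        omega
    _ = τ * ∑ j ∈ Finset.range K, d j := by simp [Finset.mul_sum]

theorem sum_norm_sub_delay_sq_le {x : ℕ → E} (h01 : x 1 = x 0) {K τ : ℕ} {t : ℕ → ℕ}
    (ht : ∀ k ∈ Finset.Icc 1 K, t k ≤ τ) :
    ∑ k ∈ Finset.Icc 1 K, ‖x k - x (k - t k)‖ ^ 2
      ≤ (τ : ℝ) ^ 2 * ∑ k ∈ Finset.Icc 1 K, ‖x (k + 1) - x k‖ ^ 2 := by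
  have hrange : ∑ j ∈ Finset.range K, ‖x (j + 1) - x j‖ ^ 2
      ≤ ∑ k ∈ Finset.Icc 1 K, ‖x (k + 1) - x k‖ ^ 2 := by
    rw [← Finset.sum_insert_zero (a := 0) (s := Finset.Icc 1 K) (by simp [h01])]
    refine Finset.sum_le_sum_of_subset_of_nonneg (fun j hj => ?_) fun _ _ _ => sq_nonneg _
    simp only [Finset.mem_range, Finset.mem_insert, Finset.mem_Icc] at hj ⊢
    omega
  calc ∑ k ∈ Finset.Icc 1 K, ‖x k - x (k - t k)‖ ^ 2
      ≤ ∑ k ∈ Finset.Icc 1 K, τ * ∑ j ∈ Finset.Ico (k - τ) k, ‖x (j + 1) - x j‖ ^ 2 :=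
        Finset.sum_le_sum fun k hk => norm_sub_delay_sq_le x k (ht k hk)
    _ ≤ τ * (τ * ∑ k ∈ Finset.Icc 1 K, ‖x (k + 1) - x k‖ ^ 2) := by
        rw [← Finset.mul_sum]
        gcongr
        exact (sum_sum_Ico_sub_le (fun _ => sq_nonneg _) K τ).trans (by gcongr)
    _ = (τ : ℝ) ^ 2 * ∑ k ∈ Finset.Icc 1 K, ‖x (k + 1) - x k‖ ^ 2 := by ring

theorem sum_norm_sub_prev_sq_le {x : ℕ → E} (h01 : x 1 = x 0) (K : ℕ) :
    ∑ k ∈ Finset.Icc 1 K, ‖x k - x (k - 1)‖ ^ 2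
      ≤ ∑ k ∈ Finset.Icc 1 K, ‖x (k + 1) - x k‖ ^ 2 := by
  simpa using sum_norm_sub_delay_sq_le h01 (K := K) (τ := 1) (t := fun _ => 1) (by simp)

end Delay

theorem sum_Icc_one_sub {M : Type*} [AddCommGroup M] (u : ℕ → M) (K : ℕ) :
    ∑ k ∈ Finset.Icc 1 K, (u (k + 1) - u k) = u (K + 1) - u 1 := by
  rw [← Finset.Ico_add_one_right_eq_Icc]
  exact Finset.sum_Ico_sub u (Nat.le_add_left 1 K)

/-! ### Deterministic estimates along a path -/

/-- A single trajectory of the inertial method with constant stepsize `a` and inertia `b`, in which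
the sample gradient of iteration `k` is the delayed gradient `∇F (x (k - t k))` perturbed by an
arbitrary error `e k`. -/
structure IsInertialPath {n : ℕ} (F : Vec n → ℝ) (r : Vec n → EReal) (a b : ℝ) (τ K : ℕ)
    (t : ℕ → ℕ) (e x : ℕ → Vec n) : Prop where
  init_mem : x 0 ∈ effDom r
  init_eq : x 1 = x 0
  delay_le : ∀ k ∈ Finset.Icc 1 K, t k ≤ τ
  step : ∀ k ∈ Finset.Icc 1 K,
    IsProx a r (x k - a • (gradient F (x (k - t k)) + e k) + b • (x k - x (k - 1))) (x (k + 1))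

/-- The coefficient `γ̃` with which squared displacements enter the decrease of the objective. -/
noncomputable def descentRate (ρ a b : ℝ) (τ : ℕ) : ℝ :=
  1 / 2 - a * ρ / 2 - (τ : ℝ) ^ 2 * a ^ 2 * ρ ^ 2 - b

/-- The coefficient with which squared displacements, through inertia and delay, enter the decrease
of the Moreau envelope. -/
noncomputable def errorCoeff (ρ ρbar a b : ℝ) (τ : ℕ) : ℝ :=
  ρbar * (2 + 4 / (a * (ρbar - ρ))) * b ^ 2
    + (τ : ℝ) ^ 2 * ρbar * ρ ^ 2 / 2 * (a ^ 2 + a / (ρbar - ρ))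

namespace IsInertialPath

variable {n : ℕ} {F : Vec n → ℝ} {r : Vec n → EReal} {ρ ρbar a b : ℝ} {τ K : ℕ} {t : ℕ → ℕ}
  {e x : ℕ → Vec n}

theorem mem_effDom (hx : IsInertialPath F r a b τ K t e x) :
    ∀ k ≤ K + 1, x k ∈ effDom r
  | 0, _ => hx.init_mem
  | 1, _ => hx.init_eq ▸ hx.init_mem
  | k + 2, hk => (hx.step (k + 1) (Finset.mem_Icc.2 ⟨by omega, by omega⟩)).mem_effDom
      ⟨x 0, hx.init_mem⟩

theorem mem_effDom_delay (hx : IsInertialPath F r a b τ K t e x) {k : ℕ}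
    (hk : k ∈ Finset.Icc 1 K) (j : ℕ) : x (k - j) ∈ effDom r :=
  hx.mem_effDom _ ((Nat.sub_le k j).trans ((Finset.mem_Icc.1 hk).2.trans (Nat.le_succ K)))

theorem descentRate_mul_sum_norm_sub_sq_le (hx : IsInertialPath F r a b τ K t e x)
    (hr : ProperClosedConvex r) (hF : SmoothIn ρ F (effDom r))
    (hbdd : (⨅ x, objective F r x) ≠ ⊥) (ha : 0 < a) (hb : 0 ≤ b) :
    descentRate ρ a b τ * ∑ k ∈ Finset.Icc 1 K, ‖x (k + 1) - x k‖ ^ 2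
      ≤ a * ((objective F r (x 0)).toReal - optVal (objective F r))
        + a ^ 2 * ∑ k ∈ Finset.Icc 1 K, ‖e k‖ ^ 2 := by
  have hsum := Finset.sum_le_sum fun k hk => (hx.step k hk).mul_objective_sub_le_sq hr hF ha hb
    (hx.mem_effDom k (Nat.le_succ_of_le (Finset.mem_Icc.1 hk).2)) (hx.mem_effDom_delay hk (t k))
  simp only [Finset.sum_add_distrib, ← Finset.mul_sum,
    sum_Icc_one_sub (fun k => (objective F r (x k)).toReal), hx.init_eq] at hsum
  have hopt := mul_le_mul_of_nonneg_left (optVal_le_toReal hbdd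
    ((effDom_objective F r).symm ▸ hx.mem_effDom (K + 1) le_rfl)) ha.le
  have hdelay := mul_le_mul_of_nonneg_left (sum_norm_sub_delay_sq_le hx.init_eq hx.delay_le)
    (mul_nonneg (sq_nonneg a) (sq_nonneg ρ))
  have hprev := mul_le_mul_of_nonneg_left (sum_norm_sub_prev_sq_le hx.init_eq K)
    (div_nonneg hb zero_le_two)
  rw [descentRate]
  linarith

theorem sum_norm_sub_prox_sq_le (hx : IsInertialPath F r a b τ K t e x)
    (hr : ProperClosedConvex r) (hF : SmoothIn ρ F (effDom r))
    (hbdd : (⨅ x, objective F r x) ≠ ⊥) (hρ : 0 ≤ ρ) (hρbar : ρ < ρbar) (ha : 0 < a) (hb : 0 ≤ b)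
    (haρ : a * ρbar ≤ 1) :
    a * (ρbar - ρ) * ρbar / 8
        * ∑ k ∈ Finset.Icc 1 K, ‖x k - prox (1 / ρbar) (objective F r) (x k)‖ ^ 2
      ≤ moreau (1 / ρbar) (objective F r) (x 0) - optVal (objective F r)
        + errorCoeff ρ ρbar a b τ * ∑ k ∈ Finset.Icc 1 K, ‖x (k + 1) - x k‖ ^ 2
        + ρbar / 2 * a ^ 2 * ∑ k ∈ Finset.Icc 1 K, ‖e k‖ ^ 2
        - ρbar * a * ∑ k ∈ Finset.Icc 1 K,
          ⟪drift F r ρbar a b (x k) (x (k - 1)) (x (k - t k)), e k⟫_ℝ := by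
  have hpos : 0 < ρbar := hρ.trans_lt hρbar
  have : 0 < ρbar - ρ := sub_pos.2 hρbar
  have hsum := Finset.sum_le_sum fun k hk => (hx.step k hk).moreau_le_sub hr hF hbdd hρ hρbar ha
    hb haρ (hx.mem_effDom k (Nat.le_succ_of_le (Finset.mem_Icc.1 hk).2))
    (hx.mem_effDom_delay hk (t k))
  have htelescope := sum_Icc_one_sub (fun k => moreau (1 / ρbar) (objective F r) (x k)) K
  simp only [Finset.sum_add_distrib, Finset.sum_sub_distrib, ← Finset.mul_sum] at hsum
  rw [Finset.sum_sub_distrib, hx.init_eq] at htelescope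
  have hopt := (isProx_prox_objective hr hF hbdd (one_div_pos.2 hpos) (x (K + 1))).optVal_le_moreau
    hr hbdd (one_div_pos.2 hpos)
  have hdelay := mul_le_mul_of_nonneg_left (sum_norm_sub_delay_sq_le hx.init_eq hx.delay_le)
    (by positivity : 0 ≤ ρbar * ρ ^ 2 / 2 * (a ^ 2 + a / (ρbar - ρ)))
  have hprev := mul_le_mul_of_nonneg_left (sum_norm_sub_prev_sq_le hx.init_eq K)
    (by positivity : 0 ≤ ρbar * (2 + 4 / (a * (ρbar - ρ))) * b ^ 2)
  rw [errorCoeff]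
  linarith

end IsInertialPath

/-! ### Measurability and integrability -/

theorem measurable_comp_of_continuousOn {α β γ : Type*} {m : MeasurableSpace α}
    [TopologicalSpace β] [MeasurableSpace β] [OpensMeasurableSpace β]
    [TopologicalSpace γ] [MeasurableSpace γ] [BorelSpace γ] {g : β → γ} {S : Set β}
    (hg : ContinuousOn g S) {X : α → β} (hX : Measurable X) (hXS : ∀ a, X a ∈ S) :
    Measurable fun a => g (X a) :=
  hg.domRestrict.measurable.comp (hX.subtype_mk (h := hXS))

theorem measurable_delay {α E : Type*} {m : MeasurableSpace α} [MeasurableSpace E]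
    {x : ℕ → α → E} {k : ℕ} (hx : ∀ j ≤ k, Measurable (x j)) {t : α → ℕ} (ht : Measurable t) :
    Measurable fun a => x (k - t a) a :=
  (measurable_from_prod_countable_right (f := fun p : ℕ × α => x (k - p.1) p.2)
    fun j => hx (k - j) (Nat.sub_le k j)).comp (ht.prodMk measurable_id)

section Lp

variable {α E E' : Type*} {m : MeasurableSpace α} {μ : Measure α} [NormedAddCommGroup E]
  [NormedAddCommGroup E']

theorem memLp_comp_of_lipschitzWith [IsFiniteMeasure μ] {p : ENNReal} {g : E → E'} {L : NNReal}
    (hg : LipschitzWith L g) {X : α → E} (hX : MemLp X p μ) : MemLp (fun a => g (X a)) p μ := by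
  have hcentered : LipschitzWith L fun y => g y - g 0 :=
    LipschitzWith.of_dist_le_mul fun y z => by simpa using hg.dist_le_mul y z
  simpa [Function.comp_def, Pi.add_def] using
    (hcentered.comp_memLp (sub_self _) hX).add (memLp_const (g 0))

theorem memLp_delay {p : ENNReal} {x : ℕ → α → E} {k : ℕ} (hx : ∀ j ≤ k, MemLp (x j) p μ)
    {t : α → ℕ} (hxt : AEStronglyMeasurable (fun a => x (k - t a) a) μ) :
    MemLp (fun a => x (k - t a) a) p μ := by
  have hsum : MemLp (fun a => ∑ j ∈ Finset.range (k + 1), ‖x j a‖) p μ :=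
    memLp_finsetSum _ fun j hj => (hx j (Finset.mem_range_succ_iff.1 hj)).norm
  refine hsum.mono hxt (.of_forall fun a => le_trans ?_ (Real.le_norm_self _))
  exact Finset.single_le_sum (f := fun j => ‖x j a‖) (fun _ _ => norm_nonneg _)
    (Finset.mem_range_succ_iff.2 (Nat.sub_le k (t a)))

theorem integrable_inner_of_memLp_two [InnerProductSpace ℝ E] {X Y : α → E} (hX : MemLp X 2 μ)
    (hY : MemLp Y 2 μ) : Integrable (fun a => ⟪X a, Y a⟫_ℝ) μ :=
  (hX.norm.integrable_mul hY.norm).mono' (hX.1.inner hY.1)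
    (.of_forall fun _ => norm_inner_le_norm _ _)

theorem memLp_two_of_lintegral_le {X : α → E} (hX : AEStronglyMeasurable X μ) {c : ℝ}
    (h : ∫⁻ a, ENNReal.ofReal (‖X a‖ ^ 2) ∂μ ≤ ENNReal.ofReal c) : MemLp X 2 μ := by
  refine (memLp_two_iff_integrable_sq_norm hX).2 ⟨hX.norm.pow 2, ?_⟩
  rw [hasFiniteIntegral_iff_ofReal (.of_forall fun a => sq_nonneg ‖X a‖)]
  exact h.trans_lt ENNReal.ofReal_lt_top

theorem integral_norm_sq_le_of_lintegral_le {X : α → E} (hX : AEStronglyMeasurable X μ) {c : ℝ}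
    (hc : 0 ≤ c) (h : ∫⁻ a, ENNReal.ofReal (‖X a‖ ^ 2) ∂μ ≤ ENNReal.ofReal c) :
    ∫ a, ‖X a‖ ^ 2 ∂μ ≤ c := by
  rw [integral_eq_lintegral_of_nonneg_ae (.of_forall fun a => sq_nonneg ‖X a‖) (hX.norm.pow 2)]
  exact ENNReal.toReal_le_of_le_ofReal hc h

end Lp

/-! ### Random indices -/

namespace IsRandomIndex

variable {n K : ℕ} {Ω : Type*} {mΩ : MeasurableSpace Ω} {P : Measure Ω} {a : ℕ → ℝ}
  {x : ℕ → Ω → Vec n} {T : Ω → ℕ}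

theorem measurableSet_eq (hT : IsRandomIndex P a K x T) (k : ℕ) : MeasurableSet {ω | T ω = k} :=
  hT.measurable (measurableSet_singleton k)

theorem ae_mem_Icc [IsProbabilityMeasure P] (hT : IsRandomIndex P a K x T)
    (ha : ∑ j ∈ Finset.Icc 1 K, a j ≠ 0) : ∀ᵐ ω ∂P, T ω ∈ Finset.Icc 1 K := by
  have hreal : P.real (T ⁻¹' ↑(Finset.Icc 1 K)) = 1 := by
    rw [← sum_measureReal_preimage_singleton _ fun k _ => hT.measurableSet_eq k]
    exact (Finset.sum_congr rfl hT.law).trans (by rw [← Finset.sum_div, div_self ha])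
  refine (mem_ae_iff_prob_eq_one (hT.measurable (Finset.measurableSet _))).2 ?_
  rwa [measureReal_def, ENNReal.toReal_eq_one_iff] at hreal

theorem setIntegral_comp (hT : IsRandomIndex P a K x T) (hx : ∀ k ≤ K, Measurable (x k))
    {q : Vec n → ℝ} (hq : Measurable q) {k : ℕ} (hk : k ∈ Finset.Icc 1 K) :
    ∫ ω in {ω | T ω = k}, q (x (T ω) ω) ∂P
      = a k / (∑ j ∈ Finset.Icc 1 K, a j) * ∫ ω, q (x k ω) ∂P := by
  have hkK : k < K + 1 := Nat.lt_succ_of_le (Finset.mem_Icc.1 hk).2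
  have hpath : Measurable fun ω (j : Fin (K + 1)) => x j ω :=
    measurable_pi_lambda _ fun j => hx j (Nat.le_of_lt_succ j.2)
  have hcoord : Measurable fun y : Fin (K + 1) → Vec n => q (y ⟨k, hkK⟩) :=
    hq.comp (measurable_pi_apply _)
  have hindep := hT.indep
  rw [IndepFun_iff_Indep] at hindep
  calc ∫ ω in {ω | T ω = k}, q (x (T ω) ω) ∂P = ∫ ω in {ω | T ω = k}, q (x k ω) ∂P :=
        setIntegral_congr_fun (hT.measurableSet_eq k) fun ω (hω : T ω = k) => by rw [hω]
    _ = P.real {ω | T ω = k} * ∫ ω, q (x k ω) ∂P :=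
        hindep.setIntegral_eq_mul hT.measurable.comap_le hpath.aemeasurable
          ⟨{k}, measurableSet_singleton k, rfl⟩ hcoord.aestronglyMeasurable
    _ = a k / (∑ j ∈ Finset.Icc 1 K, a j) * ∫ ω, q (x k ω) ∂P := by rw [hT.law k hk]

theorem integrableOn_comp (hT : IsRandomIndex P a K x T) {q : Vec n → ℝ} {k : ℕ}
    (hint : Integrable (fun ω => q (x k ω)) P) :
    IntegrableOn (fun ω => q (x (T ω) ω)) {ω | T ω = k} P :=
  hint.integrableOn.congr_fun (fun ω (hω : T ω = k) => by rw [hω]) (hT.measurableSet_eq k)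

variable [IsProbabilityMeasure P]

theorem restrict_iUnion_eq (hT : IsRandomIndex P a K x T)
    (ha : ∑ j ∈ Finset.Icc 1 K, a j ≠ 0) :
    P.restrict (⋃ k ∈ Finset.Icc 1 K, {ω | T ω = k}) = P :=
  Measure.restrict_eq_self_of_ae_mem <| (hT.ae_mem_Icc ha).mono fun ω hω =>
    Set.mem_biUnion (x := T ω) hω rfl

theorem integrable_comp (hT : IsRandomIndex P a K x T) (ha : ∑ j ∈ Finset.Icc 1 K, a j ≠ 0)
    {q : Vec n → ℝ} (hint : ∀ k ∈ Finset.Icc 1 K, Integrable (fun ω => q (x k ω)) P) :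
    Integrable (fun ω => q (x (T ω) ω)) P := by
  rw [← hT.restrict_iUnion_eq ha]
  exact integrableOn_finset_iUnion.2 fun k hk => hT.integrableOn_comp (hint k hk)

theorem integral_comp (hT : IsRandomIndex P a K x T) (ha : ∑ j ∈ Finset.Icc 1 K, a j ≠ 0)
    (hx : ∀ k ≤ K, Measurable (x k)) {q : Vec n → ℝ} (hq : Measurable q)
    (hint : ∀ k ∈ Finset.Icc 1 K, Integrable (fun ω => q (x k ω)) P) :
    ∫ ω, q (x (T ω) ω) ∂P
      = ∑ k ∈ Finset.Icc 1 K, a k / (∑ j ∈ Finset.Icc 1 K, a j) * ∫ ω, q (x k ω) ∂P := by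
  nth_rw 1 [← hT.restrict_iUnion_eq ha]
  rw [integral_biUnion_finset _ (fun k _ => hT.measurableSet_eq k) ?_ fun k hk =>
    hT.integrableOn_comp (hint k hk)]
  · exact Finset.sum_congr rfl fun k hk => hT.setIntegral_comp hx hq hk
  · exact fun i _ j _ hij => Set.disjoint_left.2 fun ω hi hj => hij (hi.symm.trans hj)

end IsRandomIndex

/-! ### Expected decrease under orthogonal noise -/

/-- A random trajectory of the inertial method whose gradient errors `e k` are square-integrable
noise: iterate and delay of iteration `k` are known at time `k`, and `e k` has second moment at
most `σ²` and is orthogonal to every square-integrable vector known at time `k`. -/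
structure IsNoisyInertialPath {n : ℕ} {Ω : Type*} {mΩ : MeasurableSpace Ω} (P : Measure Ω)
    (ℱ : Filtration ℕ mΩ) (F : Vec n → ℝ) (r : Vec n → EReal) (a b σ : ℝ) (τ K : ℕ)
    (t : ℕ → Ω → ℕ) (e : ℕ → Ω → Vec n) (x₀ : Vec n) (x : ℕ → Ω → Vec n) : Prop where
  path : ∀ ω, IsInertialPath F r a b τ K (t · ω) (e · ω) (x · ω)
  init : ∀ ω, x 0 ω = x₀
  adapted : ∀ k ≤ K + 1, Measurable[ℱ k] (x k)
  delay_adapted : ∀ k ∈ Finset.Icc 1 K, Measurable[ℱ k] (t k)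
  noise_memLp : ∀ k ∈ Finset.Icc 1 K, MemLp (e k) 2 P
  noise_sq_le : ∀ k ∈ Finset.Icc 1 K, ∫ ω, ‖e k ω‖ ^ 2 ∂P ≤ σ ^ 2
  noise_orthogonal : ∀ k ∈ Finset.Icc 1 K, ∀ u : Ω → Vec n, Measurable[ℱ k] u → MemLp u 2 P →
    ∫ ω, ⟪u ω, e k ω⟫_ℝ ∂P = 0

theorem SmoothIn.continuousOn_gradient {n : ℕ} {ρ : ℝ} {F : Vec n → ℝ} {S : Set (Vec n)}
    (hF : SmoothIn ρ F S) : ContinuousOn (gradient F) S :=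
  (LipschitzOnWith.of_dist_le_mul (K := ρ.toNNReal) fun x hx y hy => by
    rw [dist_eq_norm, dist_eq_norm]
    exact (hF.lipschitz x hx y hy).trans
      (mul_le_mul_of_nonneg_right (Real.le_coe_toNNReal ρ) (norm_nonneg _))).continuousOn

theorem one_div_mul_lt_one {ρ ρbar : ℝ} (hρ : 0 ≤ ρ) (hρbar : ρ < ρbar) : 1 / ρbar * ρ < 1 := by
  rwa [one_div_mul_eq_div, div_lt_one (hρ.trans_lt hρbar)]

theorem measurable_norm_gradient_moreau_sq {n : ℕ} {F : Vec n → ℝ} {r : Vec n → EReal} {ρ t : ℝ}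
    (hr : ProperClosedConvex r) (hF : SmoothIn ρ F (effDom r))
    (hbdd : (⨅ x, objective F r x) ≠ ⊥) (ht : 0 < t) (htρ : t * ρ < 1) :
    Measurable fun y => ‖gradient (moreau t (objective F r)) y‖ ^ 2 := by
  simp only [norm_gradient_moreau_sq hr hF hbdd ht htρ]
  have := (lipschitzWith_prox_objective hr hF hbdd ht htρ).continuous
  fun_prop

theorem measurable_drift {n : ℕ} {α : Type*} {m : MeasurableSpace α} {F : Vec n → ℝ}
    {r : Vec n → EReal} {ρ ρbar a b : ℝ} (hr : ProperClosedConvex r)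
    (hF : SmoothIn ρ F (effDom r)) (hbdd : (⨅ x, objective F r x) ≠ ⊥) (hρ : 0 ≤ ρ)
    (hρbar : ρ < ρbar) {X Xprev Y : α → Vec n} (hX : Measurable X) (hXprev : Measurable Xprev)
    (hY : Measurable Y) (hYr : ∀ ω, Y ω ∈ effDom r) :
    Measurable fun ω => drift F r ρbar a b (X ω) (Xprev ω) (Y ω) := by
  have ht : 0 < 1 / ρbar := one_div_pos.2 (hρ.trans_lt hρbar)
  have hprox : Measurable fun ω => prox (1 / ρbar) (objective F r) (X ω) :=
    (lipschitzWith_prox_objective hr hF hbdd ht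
      (one_div_mul_lt_one hρ hρbar)).continuous.measurable.comp hX
  have hgrad := measurable_comp_of_continuousOn hF.continuousOn_gradient hY hYr
  have hgrad_prox := measurable_comp_of_continuousOn hF.continuousOn_gradient hprox
    fun ω => prox_objective_mem_effDom hr hF hbdd ht (X ω)
  unfold drift
  fun_prop

namespace IsNoisyInertialPath

variable {n : ℕ} {Ω : Type*} {mΩ : MeasurableSpace Ω} {P : Measure Ω} {ℱ : Filtration ℕ mΩ}
  {F : Vec n → ℝ} {r : Vec n → EReal} {ρ ρbar a b σ : ℝ} {τ K : ℕ} {t : ℕ → Ω → ℕ}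
  {e x : ℕ → Ω → Vec n} {x₀ : Vec n}

theorem measurable (hx : IsNoisyInertialPath P ℱ F r a b σ τ K t e x₀ x) {k : ℕ}
    (hk : k ≤ K + 1) : Measurable (x k) :=
  (hx.adapted k hk).mono (ℱ.le k) le_rfl

theorem adapted_of_le (hx : IsNoisyInertialPath P ℱ F r a b σ τ K t e x₀ x) {j k : ℕ}
    (hk : k ∈ Finset.Icc 1 K) (hj : j ≤ k) : Measurable[ℱ k] (x j) :=
  (hx.adapted j (hj.trans (Nat.le_succ_of_le (Finset.mem_Icc.1 hk).2))).mono (ℱ.mono hj) le_rfl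

theorem adapted_delay (hx : IsNoisyInertialPath P ℱ F r a b σ τ K t e x₀ x) {k : ℕ}
    (hk : k ∈ Finset.Icc 1 K) : Measurable[ℱ k] fun ω => x (k - t k ω) ω :=
  measurable_delay (m := ℱ k) (fun _ hj => hx.adapted_of_le hk hj) (hx.delay_adapted k hk)

theorem adapted_drift (hx : IsNoisyInertialPath P ℱ F r a b σ τ K t e x₀ x)
    (hr : ProperClosedConvex r) (hF : SmoothIn ρ F (effDom r))
    (hbdd : (⨅ x, objective F r x) ≠ ⊥) (hρ : 0 ≤ ρ) (hρbar : ρ < ρbar) {k : ℕ}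
    (hk : k ∈ Finset.Icc 1 K) :
    Measurable[ℱ k] fun ω => drift F r ρbar a b (x k ω) (x (k - 1) ω) (x (k - t k ω) ω) :=
  measurable_drift (m := ℱ k) hr hF hbdd hρ hρbar (hx.adapted_of_le hk le_rfl)
    (hx.adapted_of_le hk (Nat.sub_le k 1)) (hx.adapted_delay hk)
    fun ω => (hx.path ω).mem_effDom_delay hk (t k ω)

theorem integrable_sum_noise_sq (hx : IsNoisyInertialPath P ℱ F r a b σ τ K t e x₀ x) :
    Integrable (fun ω => ∑ k ∈ Finset.Icc 1 K, ‖e k ω‖ ^ 2) P :=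
  integrable_finsetSum _ fun k hk => (hx.noise_memLp k hk).norm.integrable_sq

theorem integral_sum_noise_sq_le (hx : IsNoisyInertialPath P ℱ F r a b σ τ K t e x₀ x) :
    ∫ ω, ∑ k ∈ Finset.Icc 1 K, ‖e k ω‖ ^ 2 ∂P ≤ K * σ ^ 2 := by
  rw [integral_finsetSum _ fun k hk => (hx.noise_memLp k hk).norm.integrable_sq]
  exact (Finset.sum_le_sum hx.noise_sq_le).trans_eq (by simp)

variable [IsProbabilityMeasure P]

theorem memLp_sub_succ (hx : IsNoisyInertialPath P ℱ F r a b σ τ K t e x₀ x)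
    (hr : ProperClosedConvex r) (hF : SmoothIn ρ F (effDom r))
    (hbdd : (⨅ x, objective F r x) ≠ ⊥) (ha : 0 < a) (hb : 0 ≤ b)
    (hγ : 0 < descentRate ρ a b τ) {k : ℕ} (hk : k ∈ Finset.Icc 1 K) :
    MemLp (fun ω => x (k + 1) ω - x k ω) 2 P := by
  obtain ⟨-, hkK⟩ := Finset.mem_Icc.1 hk
  have hmeas : Measurable fun ω => x (k + 1) ω - x k ω :=
    (hx.measurable (Nat.succ_le_succ hkK)).sub (hx.measurable (Nat.le_succ_of_le hkK))
  have hint := ((integrable_const (a * ((objective F r x₀).toReal - optVal (objective F r)))).add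
    (hx.integrable_sum_noise_sq.const_mul (a ^ 2))).const_mul (descentRate ρ a b τ)⁻¹
  refine (memLp_two_iff_integrable_sq_norm hmeas.aestronglyMeasurable).2
    (hint.mono' (hmeas.norm.pow_const 2).aestronglyMeasurable (.of_forall fun ω => ?_))
  rw [Real.norm_of_nonneg (sq_nonneg _), le_inv_mul_iff₀ hγ]
  have hpath := (hx.path ω).descentRate_mul_sum_norm_sub_sq_le hr hF hbdd ha hb
  rw [hx.init] at hpath
  refine (mul_le_mul_of_nonneg_left ?_ hγ.le).trans hpath
  exact Finset.single_le_sum (f := fun k => ‖x (k + 1) ω - x k ω‖ ^ 2) (fun _ _ => sq_nonneg _) hk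

theorem integrable_sum_norm_sub_sq (hx : IsNoisyInertialPath P ℱ F r a b σ τ K t e x₀ x)
    (hr : ProperClosedConvex r) (hF : SmoothIn ρ F (effDom r))
    (hbdd : (⨅ x, objective F r x) ≠ ⊥) (ha : 0 < a) (hb : 0 ≤ b)
    (hγ : 0 < descentRate ρ a b τ) :
    Integrable (fun ω => ∑ k ∈ Finset.Icc 1 K, ‖x (k + 1) ω - x k ω‖ ^ 2) P :=
  integrable_finsetSum _ fun _ hk =>
    (hx.memLp_sub_succ hr hF hbdd ha hb hγ hk).norm.integrable_sq

theorem integral_sum_norm_sub_sq_le (hx : IsNoisyInertialPath P ℱ F r a b σ τ K t e x₀ x)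
    (hr : ProperClosedConvex r) (hF : SmoothIn ρ F (effDom r))
    (hbdd : (⨅ x, objective F r x) ≠ ⊥) (ha : 0 < a) (hb : 0 ≤ b)
    (hγ : 0 < descentRate ρ a b τ) :
    ∫ ω, ∑ k ∈ Finset.Icc 1 K, ‖x (k + 1) ω - x k ω‖ ^ 2 ∂P
      ≤ 1 / descentRate ρ a b τ * (a * ((objective F r x₀).toReal - optVal (objective F r))
        + a ^ 2 * (K * σ ^ 2)) := by
  rw [one_div, le_inv_mul_iff₀ hγ, ← integral_const_mul]
  have hnoise := hx.integrable_sum_noise_sq.const_mul (a ^ 2)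
  calc ∫ ω, descentRate ρ a b τ * ∑ k ∈ Finset.Icc 1 K, ‖x (k + 1) ω - x k ω‖ ^ 2 ∂P
      ≤ ∫ ω, (a * ((objective F r x₀).toReal - optVal (objective F r))
          + a ^ 2 * ∑ k ∈ Finset.Icc 1 K, ‖e k ω‖ ^ 2) ∂P := by
        refine integral_mono ((hx.integrable_sum_norm_sub_sq hr hF hbdd ha hb hγ).const_mul _)
          ((integrable_const _).add hnoise) fun ω => ?_
        simpa only [hx.init] using (hx.path ω).descentRate_mul_sum_norm_sub_sq_le hr hF hbdd ha hb
    _ = a * ((objective F r x₀).toReal - optVal (objective F r))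
          + a ^ 2 * ∫ ω, ∑ k ∈ Finset.Icc 1 K, ‖e k ω‖ ^ 2 ∂P := by
        rw [integral_add (integrable_const _) hnoise, integral_const, probReal_univ, one_smul,
          integral_const_mul]
    _ ≤ a * ((objective F r x₀).toReal - optVal (objective F r)) + a ^ 2 * (K * σ ^ 2) := by
        gcongr
        exact hx.integral_sum_noise_sq_le

theorem memLp (hx : IsNoisyInertialPath P ℱ F r a b σ τ K t e x₀ x)
    (hr : ProperClosedConvex r) (hF : SmoothIn ρ F (effDom r))
    (hbdd : (⨅ x, objective F r x) ≠ ⊥) (ha : 0 < a) (hb : 0 ≤ b)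
    (hγ : 0 < descentRate ρ a b τ) : ∀ k ≤ K + 1, MemLp (x k) 2 P
  | 0, _ => by
    rw [funext hx.init]
    exact memLp_const x₀
  | 1, _ => by
    rw [funext fun ω => (hx.path ω).init_eq.trans (hx.init ω)]
    exact memLp_const x₀
  | k + 2, hk => by
    have hsub := hx.memLp_sub_succ hr hF hbdd ha hb hγ
      (Finset.mem_Icc.2 ⟨Nat.le_add_left 1 k, Nat.le_of_succ_le_succ hk⟩)
    simpa only [Pi.add_def, add_sub_cancel] using
      (hx.memLp hr hF hbdd ha hb hγ (k + 1) (Nat.le_of_succ_le hk)).add hsub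

theorem memLp_sub_prox (hx : IsNoisyInertialPath P ℱ F r a b σ τ K t e x₀ x)
    (hr : ProperClosedConvex r) (hF : SmoothIn ρ F (effDom r))
    (hbdd : (⨅ x, objective F r x) ≠ ⊥) (hρ : 0 ≤ ρ) (hρbar : ρ < ρbar) (ha : 0 < a) (hb : 0 ≤ b)
    (hγ : 0 < descentRate ρ a b τ) {k : ℕ} (hk : k ∈ Finset.Icc 1 K) :
    MemLp (fun ω => x k ω - prox (1 / ρbar) (objective F r) (x k ω)) 2 P :=
  have hxk := hx.memLp hr hF hbdd ha hb hγ k (Nat.le_succ_of_le (Finset.mem_Icc.1 hk).2)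
  hxk.sub (memLp_comp_of_lipschitzWith (lipschitzWith_prox_objective hr hF hbdd
    (one_div_pos.2 (hρ.trans_lt hρbar)) (one_div_mul_lt_one hρ hρbar)) hxk)

theorem memLp_drift (hx : IsNoisyInertialPath P ℱ F r a b σ τ K t e x₀ x)
    (hr : ProperClosedConvex r) (hF : SmoothIn ρ F (effDom r))
    (hbdd : (⨅ x, objective F r x) ≠ ⊥) (hρ : 0 ≤ ρ) (hρbar : ρ < ρbar) (ha : 0 < a) (hb : 0 ≤ b)
    (haρ : a * ρbar ≤ 1) (hγ : 0 < descentRate ρ a b τ) {k : ℕ} (hk : k ∈ Finset.Icc 1 K) :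
    MemLp (fun ω => drift F r ρbar a b (x k ω) (x (k - 1) ω) (x (k - t k ω) ω)) 2 P := by
  have hkK : k ≤ K + 1 := Nat.le_succ_of_le (Finset.mem_Icc.1 hk).2
  have hxj : ∀ j ≤ k, MemLp (x j) 2 P := fun j hj =>
    hx.memLp hr hF hbdd ha hb hγ j (hj.trans hkK)
  have hdelay : MemLp (fun ω => x (k - t k ω) ω) 2 P :=
    memLp_delay hxj ((hx.adapted_delay hk).mono (ℱ.le k) le_rfl).aestronglyMeasurable
  have hbound := (((hx.memLp_sub_prox hr hF hbdd hρ hρbar ha hb hγ hk).norm.const_mul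
    (1 - a * (ρbar - ρ))).add ((((hxj k le_rfl).sub hdelay).norm.const_mul ρ).const_mul a)).add
    (((hxj k le_rfl).sub (hxj (k - 1) (Nat.sub_le k 1))).norm.const_mul b)
  refine hbound.mono ((hx.adapted_drift hr hF hbdd hρ hρbar hk).mono (ℱ.le k)
    le_rfl).aestronglyMeasurable (.of_forall fun ω => ?_)
  exact (norm_drift_le hr hF hbdd (hρ.trans_lt hρbar) ha hb haρ ((hx.path ω).mem_effDom k hkK)
    ((hx.path ω).mem_effDom_delay hk (t k ω))).trans (Real.le_norm_self _)

theorem integrable_sum_inner_drift_noise (hx : IsNoisyInertialPath P ℱ F r a b σ τ K t e x₀ x)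
    (hr : ProperClosedConvex r) (hF : SmoothIn ρ F (effDom r))
    (hbdd : (⨅ x, objective F r x) ≠ ⊥) (hρ : 0 ≤ ρ) (hρbar : ρ < ρbar) (ha : 0 < a) (hb : 0 ≤ b)
    (haρ : a * ρbar ≤ 1) (hγ : 0 < descentRate ρ a b τ) :
    Integrable (fun ω => ∑ k ∈ Finset.Icc 1 K,
      ⟪drift F r ρbar a b (x k ω) (x (k - 1) ω) (x (k - t k ω) ω), e k ω⟫_ℝ) P :=
  integrable_finsetSum _ fun k hk => integrable_inner_of_memLp_two
    (hx.memLp_drift hr hF hbdd hρ hρbar ha hb haρ hγ hk) (hx.noise_memLp k hk)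

theorem integral_sum_inner_drift_noise (hx : IsNoisyInertialPath P ℱ F r a b σ τ K t e x₀ x)
    (hr : ProperClosedConvex r) (hF : SmoothIn ρ F (effDom r))
    (hbdd : (⨅ x, objective F r x) ≠ ⊥) (hρ : 0 ≤ ρ) (hρbar : ρ < ρbar) (ha : 0 < a) (hb : 0 ≤ b)
    (haρ : a * ρbar ≤ 1) (hγ : 0 < descentRate ρ a b τ) :
    ∫ ω, ∑ k ∈ Finset.Icc 1 K,
      ⟪drift F r ρbar a b (x k ω) (x (k - 1) ω) (x (k - t k ω) ω), e k ω⟫_ℝ ∂P = 0 := by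
  have hdrift := fun k hk => hx.memLp_drift hr hF hbdd hρ hρbar ha hb haρ hγ (k := k) hk
  rw [integral_finsetSum _ fun k hk =>
    integrable_inner_of_memLp_two (hdrift k hk) (hx.noise_memLp k hk)]
  exact Finset.sum_eq_zero fun k hk =>
    hx.noise_orthogonal k hk _ (hx.adapted_drift hr hF hbdd hρ hρbar hk) (hdrift k hk)

theorem integral_sum_norm_sub_prox_sq_le (hx : IsNoisyInertialPath P ℱ F r a b σ τ K t e x₀ x)
    (hr : ProperClosedConvex r) (hF : SmoothIn ρ F (effDom r))
    (hbdd : (⨅ x, objective F r x) ≠ ⊥) (hρ : 0 ≤ ρ) (hρbar : ρ < ρbar) (ha : 0 < a) (hb : 0 ≤ b)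
    (haρ : a * ρbar ≤ 1) (hγ : 0 < descentRate ρ a b τ) :
    a * (ρbar - ρ) * ρbar / 8 *
        ∫ ω, ∑ k ∈ Finset.Icc 1 K, ‖x k ω - prox (1 / ρbar) (objective F r) (x k ω)‖ ^ 2 ∂P
      ≤ moreau (1 / ρbar) (objective F r) x₀ - optVal (objective F r)
        + errorCoeff ρ ρbar a b τ * ∫ ω, ∑ k ∈ Finset.Icc 1 K, ‖x (k + 1) ω - x k ω‖ ^ 2 ∂P
        + ρbar / 2 * a ^ 2 * ∫ ω, ∑ k ∈ Finset.Icc 1 K, ‖e k ω‖ ^ 2 ∂P := by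
  have hgap := integrable_const (μ := P)
    (moreau (1 / ρbar) (objective F r) x₀ - optVal (objective F r))
  have hdisp := (hx.integrable_sum_norm_sub_sq hr hF hbdd ha hb hγ).const_mul
    (errorCoeff ρ ρbar a b τ)
  have hnoise := hx.integrable_sum_noise_sq.const_mul (ρbar / 2 * a ^ 2)
  have hcross := (hx.integrable_sum_inner_drift_noise hr hF hbdd hρ hρbar ha hb haρ hγ).const_mul
    (ρbar * a)
  have hprox := (integrable_finsetSum (Finset.Icc 1 K) fun _ hk =>
    (hx.memLp_sub_prox hr hF hbdd hρ hρbar ha hb hγ hk).norm.integrable_sq).const_mul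
    (a * (ρbar - ρ) * ρbar / 8)
  have hmono := integral_mono hprox (((hgap.add hdisp).add hnoise).sub hcross) fun ω => by
    simpa only [hx.init, Pi.add_apply, Pi.sub_apply] using
      (hx.path ω).sum_norm_sub_prox_sq_le hr hF hbdd hρ hρbar ha hb haρ
  rw [integral_sub' ((hgap.add hdisp).add hnoise) hcross, integral_add' (hgap.add hdisp) hnoise,
    integral_add' hgap hdisp, integral_const, probReal_univ, one_smul] at hmono
  simp only [integral_const_mul,
    hx.integral_sum_inner_drift_noise hr hF hbdd hρ hρbar ha hb haρ hγ] at hmono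
  linarith

theorem integrable_norm_gradient_moreau_sq
    (hx : IsNoisyInertialPath P ℱ F r a b σ τ K t e x₀ x)
    (hr : ProperClosedConvex r) (hF : SmoothIn ρ F (effDom r))
    (hbdd : (⨅ x, objective F r x) ≠ ⊥) (hρ : 0 ≤ ρ) (hρbar : ρ < ρbar) (ha : 0 < a) (hb : 0 ≤ b)
    (hγ : 0 < descentRate ρ a b τ) {k : ℕ} (hk : k ∈ Finset.Icc 1 K) :
    Integrable (fun ω => ‖gradient (moreau (1 / ρbar) (objective F r)) (x k ω)‖ ^ 2) P := by
  simp only [norm_gradient_moreau_sq hr hF hbdd (one_div_pos.2 (hρ.trans_lt hρbar))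
    (one_div_mul_lt_one hρ hρbar)]
  exact (hx.memLp_sub_prox hr hF hbdd hρ hρbar ha hb hγ hk).norm.integrable_sq.const_mul _

theorem sum_integral_norm_gradient_moreau_sq_le
    (hx : IsNoisyInertialPath P ℱ F r a b σ τ K t e x₀ x)
    (hr : ProperClosedConvex r) (hF : SmoothIn ρ F (effDom r))
    (hbdd : (⨅ x, objective F r x) ≠ ⊥) (hρ : 0 ≤ ρ) (hρbar : ρ < ρbar) (ha : 0 < a) (hb : 0 ≤ b)
    (haρ : a * ρbar ≤ 1) (hγ : 0 < descentRate ρ a b τ) :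
    a * (ρbar - ρ) / (8 * ρbar) * ∑ k ∈ Finset.Icc 1 K,
        ∫ ω, ‖gradient (moreau (1 / ρbar) (objective F r)) (x k ω)‖ ^ 2 ∂P
      ≤ moreau (1 / ρbar) (objective F r) x₀ - optVal (objective F r)
        + ρbar / 2 * (a ^ 2 * (K * σ ^ 2))
        + 1 / descentRate ρ a b τ * errorCoeff ρ ρbar a b τ
          * (a * ((objective F r x₀).toReal - optVal (objective F r)) + a ^ 2 * (K * σ ^ 2)) := by
  have hpos : 0 < ρbar := hρ.trans_lt hρbar
  have hδ : 0 < ρbar - ρ := sub_pos.2 hρbar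
  have hcoeff : 0 ≤ errorCoeff ρ ρbar a b τ := by unfold errorCoeff; positivity
  have hdisp := mul_le_mul_of_nonneg_left
    (hx.integral_sum_norm_sub_sq_le hr hF hbdd ha hb hγ) hcoeff
  have hnoise := mul_le_mul_of_nonneg_left hx.integral_sum_noise_sq_le
    (by positivity : 0 ≤ ρbar / 2 * a ^ 2)
  have hprox := hx.integral_sum_norm_sub_prox_sq_le hr hF hbdd hρ hρbar ha hb haρ hγ
  rw [integral_finsetSum _ fun k hk =>
    (hx.memLp_sub_prox hr hF hbdd hρ hρbar ha hb hγ hk).norm.integrable_sq] at hprox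
  simp only [norm_gradient_moreau_sq hr hF hbdd (one_div_pos.2 hpos)
    (one_div_mul_lt_one hρ hρbar), integral_const_mul, ← Finset.mul_sum]
  have hscale : a * (ρbar - ρ) / (8 * ρbar) * (1 / ρbar)⁻¹ ^ 2 = a * (ρbar - ρ) * ρbar / 8 := by
    rw [one_div, inv_inv]
    field_simp
  rw [← mul_assoc, hscale]
  linarith

theorem integrable_norm_gradient_moreau_sq_randomIndex
    (hx : IsNoisyInertialPath P ℱ F r a b σ τ K t e x₀ x)
    (hr : ProperClosedConvex r) (hF : SmoothIn ρ F (effDom r))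
    (hbdd : (⨅ x, objective F r x) ≠ ⊥) (hρ : 0 ≤ ρ) (hρbar : ρ < ρbar) (ha : 0 < a) (hb : 0 ≤ b)
    (hγ : 0 < descentRate ρ a b τ) (hK : 0 < K) {T : Ω → ℕ}
    (hT : IsRandomIndex P (fun _ => a) K x T) :
    Integrable (fun ω => ‖gradient (moreau (1 / ρbar) (objective F r)) (x (T ω) ω)‖ ^ 2) P :=
  hT.integrable_comp (q := fun y => ‖gradient (moreau (1 / ρbar) (objective F r)) y‖ ^ 2)
    (by simp [hK.ne', ha.ne'])
    fun _ hk => hx.integrable_norm_gradient_moreau_sq hr hF hbdd hρ hρbar ha hb hγ hk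

theorem integral_norm_gradient_moreau_sq_randomIndex_le
    (hx : IsNoisyInertialPath P ℱ F r a b σ τ K t e x₀ x)
    (hr : ProperClosedConvex r) (hF : SmoothIn ρ F (effDom r))
    (hbdd : (⨅ x, objective F r x) ≠ ⊥) (hρ : 0 ≤ ρ) (hρbar : ρ < ρbar) (ha : 0 < a) (hb : 0 ≤ b)
    (haρ : a * ρbar ≤ 1) (hγ : 0 < descentRate ρ a b τ) (hK : 0 < K) {T : Ω → ℕ}
    (hT : IsRandomIndex P (fun _ => a) K x T) :
    ∫ ω, ‖gradient (moreau (1 / ρbar) (objective F r)) (x (T ω) ω)‖ ^ 2 ∂P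
      ≤ 8 * ρbar / ((ρbar - ρ) * (a * K)) *
        (moreau (1 / ρbar) (objective F r) x₀ - optVal (objective F r)
          + ρbar / 2 * (a ^ 2 * (K * σ ^ 2))
          + 1 / descentRate ρ a b τ * errorCoeff ρ ρbar a b τ
            * (a * ((objective F r x₀).toReal - optVal (objective F r))
              + a ^ 2 * (K * σ ^ 2))) := by
  have hpos : 0 < ρbar := hρ.trans_lt hρbar
  have hδ : 0 < ρbar - ρ := sub_pos.2 hρbar
  have : (0 : ℝ) < K := Nat.cast_pos.2 hK
  have hmeas : Measurable fun y => ‖gradient (moreau (1 / ρbar) (objective F r)) y‖ ^ 2 :=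
    measurable_norm_gradient_moreau_sq hr hF hbdd (one_div_pos.2 hpos)
      (one_div_mul_lt_one hρ hρbar)
  rw [hT.integral_comp (by simp [hK.ne', ha.ne'])
    (fun k hk => hx.measurable (Nat.le_succ_of_le hk)) hmeas
    fun _ hk => hx.integrable_norm_gradient_moreau_sq hr hF hbdd hρ hρbar ha hb hγ hk,
    ← Finset.mul_sum]
  have hweight : a / ∑ _j ∈ Finset.Icc 1 K, a
      = 8 * ρbar / ((ρbar - ρ) * (a * K)) * (a * (ρbar - ρ) / (8 * ρbar)) := by
    rw [Finset.sum_const, Nat.card_Icc, add_tsub_cancel_right, nsmul_eq_mul]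
    field_simp
  rw [hweight, mul_assoc]
  exact mul_le_mul_of_nonneg_left (hx.sum_integral_norm_gradient_moreau_sq_le hr hF hbdd hρ hρbar
    ha hb haρ hγ) (by positivity)

end IsNoisyInertialPath

/-! ### Fresh samples -/

section Independent

variable {Ω β Ξ E : Type*} {mΩ : MeasurableSpace Ω} [MeasurableSpace β] [MeasurableSpace Ξ]
  {P : Measure Ω} [IsFiniteMeasure P] {X : Ω → β} {ξ : Ω → Ξ}

theorem lintegral_comp_of_indepFun (hX : Measurable X) (hξ : Measurable ξ)
    (hXξ : IndepFun X ξ P) {H : β × Ξ → ENNReal} (hH : Measurable H) :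
    ∫⁻ ω, H (X ω, ξ ω) ∂P = ∫⁻ ω, ∫⁻ s, H (X ω, s) ∂P.map ξ ∂P := by
  rw [← lintegral_map (f := H) hH (hX.prodMk hξ),
    (indepFun_iff_map_prod_eq_prod_map_map hX.aemeasurable hξ.aemeasurable).1 hXξ,
    lintegral_prod _ hH.aemeasurable, lintegral_map hH.lintegral_prod_right' hX]

variable [NormedAddCommGroup E] [NormedSpace ℝ E]

theorem integral_comp_of_indepFun (hX : Measurable X) (hξ : Measurable ξ)
    (hXξ : IndepFun X ξ P) {H : β × Ξ → E} (hH : StronglyMeasurable H)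
    (hint : Integrable (fun ω => H (X ω, ξ ω)) P) :
    ∫ ω, H (X ω, ξ ω) ∂P = ∫ ω, ∫ s, H (X ω, s) ∂P.map ξ ∂P := by
  have hpair : AEMeasurable (fun ω => (X ω, ξ ω)) P := (hX.prodMk hξ).aemeasurable
  have hmap := (indepFun_iff_map_prod_eq_prod_map_map hX.aemeasurable hξ.aemeasurable).1 hXξ
  have hint_prod : Integrable H ((P.map X).prod (P.map ξ)) := by
    rw [← hmap]
    exact (integrable_map_measure hH.aestronglyMeasurable hpair).2 hint
  rw [← integral_map (f := H) hpair hH.aestronglyMeasurable, hmap, integral_prod _ hint_prod,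
    integral_map hX.aemeasurable hH.integral_prod_right'.aestronglyMeasurable]

end Independent

theorem lintegral_norm_sq_le_of_indepFun {Ω β Ξ E : Type*} {mΩ : MeasurableSpace Ω}
    [MeasurableSpace β] [MeasurableSpace Ξ] [NormedAddCommGroup E] [MeasurableSpace E]
    [OpensMeasurableSpace E] {P : Measure Ω} [IsProbabilityMeasure P] {X : Ω → β} {ξ : Ω → Ξ}
    (hX : Measurable X) (hξ : Measurable ξ) (hXξ : IndepFun X ξ P) {G : β × Ξ → E}
    (hG : Measurable G) {c : ENNReal}
    (hc : ∀ ω, ∫⁻ s, ENNReal.ofReal (‖G (X ω, s)‖ ^ 2) ∂P.map ξ ≤ c) :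
    ∫⁻ ω, ENNReal.ofReal (‖G (X ω, ξ ω)‖ ^ 2) ∂P ≤ c := by
  have hsq : Measurable fun p => ENNReal.ofReal (‖G p‖ ^ 2) := (hG.norm.pow_const 2).ennreal_ofReal
  calc ∫⁻ ω, ENNReal.ofReal (‖G (X ω, ξ ω)‖ ^ 2) ∂P
      = ∫⁻ ω, ∫⁻ s, ENNReal.ofReal (‖G (X ω, s)‖ ^ 2) ∂P.map ξ ∂P :=
        lintegral_comp_of_indepFun hX hξ hXξ hsq
    _ ≤ ∫⁻ _, c ∂P := lintegral_mono hc
    _ = c := by simp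

theorem integral_inner_eq_zero_of_indepFun {Ω β Ξ E : Type*} {mΩ : MeasurableSpace Ω}
    [MeasurableSpace β] [MeasurableSpace Ξ] [NormedAddCommGroup E] [InnerProductSpace ℝ E]
    [CompleteSpace E] [MeasurableSpace E] [BorelSpace E] [SecondCountableTopology E]
    {P : Measure Ω} [IsFiniteMeasure P] {X : Ω → β} {ξ : Ω → Ξ} {u : Ω → E} (hX : Measurable X)
    (hu : Measurable u) (hξ : Measurable ξ) (huXξ : IndepFun (fun ω => (u ω, X ω)) ξ P)
    {G : β × Ξ → E} (hG : Measurable G)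
    (hGint : ∀ ω, Integrable (fun s => G (X ω, s)) (P.map ξ))
    (hGmean : ∀ᵐ ω ∂P, ∫ s, G (X ω, s) ∂P.map ξ = 0)
    (hint : Integrable (fun ω => ⟪u ω, G (X ω, ξ ω)⟫_ℝ) P) :
    ∫ ω, ⟪u ω, G (X ω, ξ ω)⟫_ℝ ∂P = 0 := by
  have hinner : Measurable fun p : (E × β) × Ξ => ⟪p.1.1, G (p.1.2, p.2)⟫_ℝ := by fun_prop
  refine (integral_comp_of_indepFun (hu.prodMk hX) hξ huXξ hinner.stronglyMeasurable hint).trans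
    (integral_eq_zero_of_ae ?_)
  filter_upwards [hGmean] with ω hω
  rw [integral_inner (hGint ω), hω, inner_zero_right, Pi.zero_apply]

namespace IsSampling

variable {Ω Ξ β : Type*} {mΩ : MeasurableSpace Ω} [MeasurableSpace Ξ] [MeasurableSpace β]
  {P : Measure Ω} {D : Measure Ξ} {ℱ : Filtration ℕ mΩ} {ξ : ℕ → Ω → Ξ} {delay : ℕ → Ω → ℕ}
  {K k : ℕ}

theorem measurable_sample (hs : IsSampling P D ℱ ξ delay K) (hk : k ∈ Finset.Icc 1 K) :
    Measurable (ξ k) :=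
  (hs.sample_meas k hk).mono (ℱ.le _) le_rfl

theorem isProbabilityMeasure [IsProbabilityMeasure P] (hs : IsSampling P D ℱ ξ delay K)
    (hk : k ∈ Finset.Icc 1 K) : IsProbabilityMeasure D :=
  hs.sample_law k hk ▸ Measure.isProbabilityMeasure_map (hs.measurable_sample hk).aemeasurable

theorem indepFun (hs : IsSampling P D ℱ ξ delay K) (hk : k ∈ Finset.Icc 1 K) {X : Ω → β}
    (hX : Measurable[ℱ k] X) : IndepFun X (ξ k) P :=
  (IndepFun_iff_Indep _ _ _).2 (indep_of_indep_of_le_left (hs.sample_indep k hk).symm hX.comap_le)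

end IsSampling

/-- The error of the `k`-th sample gradient, `∇f(x⁽ᵏ⁻ᵗ⁾; ξ_k) - ∇F(x⁽ᵏ⁻ᵗ⁾)` with `t = τ_k`. -/
noncomputable def gradNoise {n : ℕ} {Ω Ξ : Type*} [MeasurableSpace Ξ] (D : Measure Ξ)
    (f : Vec n → Ξ → ℝ) (ξ : ℕ → Ω → Ξ) (delay : ℕ → Ω → ℕ) (x : ℕ → Ω → Vec n) (k : ℕ) (ω : Ω) :
    Vec n :=
  sampleGrad f (x (k - delay k ω) ω) (ξ k ω) - gradient (expLoss D f) (x (k - delay k ω) ω)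

namespace IsInertialRun

variable {n : ℕ} {Ω Ξ : Type*} {mΩ : MeasurableSpace Ω} [MeasurableSpace Ξ] {P : Measure Ω}
  {D : Measure Ξ} {f : Vec n → Ξ → ℝ} {r : Vec n → EReal} {ρ a b σ : ℝ} {τ K : ℕ}
  {ℱ : Filtration ℕ mΩ} {ξ : ℕ → Ω → Ξ} {delay : ℕ → Ω → ℕ} {x₀ : Vec n} {x : ℕ → Ω → Vec n}

theorem isInertialPath (hrun : IsInertialRun f r (fun _ => a) (fun _ => b) ξ delay K x₀ x)
    (hdelay : ∀ k ∈ Finset.Icc 1 K, ∀ ω, delay k ω ≤ τ) (ω : Ω) :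
    IsInertialPath (expLoss D f) r a b τ K (delay · ω) (gradNoise D f ξ delay x · ω) (x · ω) where
  init_mem := hrun.init_zero ω ▸ hrun.init_dom
  init_eq := (hrun.init_one ω).trans (hrun.init_zero ω).symm
  delay_le k hk := hdelay k hk ω
  step k hk := by
    rw [gradNoise, add_sub_cancel]
    exact hrun.step k hk ω

theorem adapted (hrun : IsInertialRun f r (fun _ => a) (fun _ => b) ξ delay K x₀ x)
    (hr : ProperClosedConvex r) (hf : Measurable fun p : Vec n × Ξ => sampleGrad f p.1 p.2)
    (hs : IsSampling P D ℱ ξ delay K) (ha : 0 < a) (k : ℕ) (hk : k ≤ K + 1) :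
    Measurable[ℱ k] (x k) := by
  induction k using Nat.strong_induction_on with
  | _ k ih =>
    obtain rfl | rfl | ⟨j, rfl⟩ : k = 0 ∨ k = 1 ∨ ∃ j, k = j + 1 + 1 := by
      rcases k with _ | _ | j <;> simp
    · rw [funext hrun.init_zero]
      exact measurable_const
    · rw [funext hrun.init_one]
      exact measurable_const
    · have hj : j + 1 ∈ Finset.Icc 1 K := Finset.mem_Icc.2 ⟨by omega, by omega⟩
      have hx : ∀ i ≤ j + 1, Measurable[ℱ (j + 1 + 1)] (x i) := fun i hi =>
        (ih i (by omega) (by omega)).mono (ℱ.mono (by omega)) le_rfl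
      have hY := measurable_delay (m := ℱ (j + 1 + 1)) hx
        ((hs.delay_meas _ hj).mono (ℱ.mono (Nat.le_succ _)) le_rfl)
      have hgrad := hf.comp (hY.prodMk (hs.sample_meas _ hj))
      have hz := ((hx (j + 1) le_rfl).sub (hgrad.const_smul a)).add
        (((hx (j + 1) le_rfl).sub (hx j (Nat.le_succ j))).const_smul b)
      rw [funext fun ω => (hrun.step (j + 1) hj ω).eq_prox hr ha]
      exact measurable_comp_of_continuousOn (m := ℱ (j + 1 + 1))
        (lipschitzOnWith_prox hr ha).continuousOn hz fun ω => ⟨_, hrun.step (j + 1) hj ω⟩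

theorem adapted_delay (hrun : IsInertialRun f r (fun _ => a) (fun _ => b) ξ delay K x₀ x)
    (hr : ProperClosedConvex r) (hf : Measurable fun p : Vec n × Ξ => sampleGrad f p.1 p.2)
    (hs : IsSampling P D ℱ ξ delay K) (ha : 0 < a) {k : ℕ} (hk : k ∈ Finset.Icc 1 K) :
    Measurable[ℱ k] fun ω => x (k - delay k ω) ω :=
  measurable_delay (m := ℱ k) (fun j hj => (hrun.adapted hr hf hs ha j (hj.trans
    (Nat.le_succ_of_le (Finset.mem_Icc.1 hk).2))).mono (ℱ.mono hj) le_rfl) (hs.delay_meas k hk)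

theorem adapted_delay_gradient
    (hrun : IsInertialRun f r (fun _ => a) (fun _ => b) ξ delay K x₀ x)
    (hr : ProperClosedConvex r) (hf : Measurable fun p : Vec n × Ξ => sampleGrad f p.1 p.2)
    (hF : SmoothIn ρ (expLoss D f) (effDom r)) (hs : IsSampling P D ℱ ξ delay K)
    (hdelay : ∀ k ∈ Finset.Icc 1 K, ∀ ω, delay k ω ≤ τ) (ha : 0 < a) {k : ℕ}
    (hk : k ∈ Finset.Icc 1 K) :
    Measurable[ℱ k] fun ω =>
      (x (k - delay k ω) ω, gradient (expLoss D f) (x (k - delay k ω) ω)) :=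
  have hY := hrun.adapted_delay hr hf hs ha hk
  hY.prodMk (measurable_comp_of_continuousOn (m := ℱ k) hF.continuousOn_gradient hY fun ω =>
    (hrun.isInertialPath (D := D) hdelay ω).mem_effDom_delay hk (delay k ω))

theorem measurable_gradNoise
    (hrun : IsInertialRun f r (fun _ => a) (fun _ => b) ξ delay K x₀ x)
    (hr : ProperClosedConvex r) (hf : Measurable fun p : Vec n × Ξ => sampleGrad f p.1 p.2)
    (hF : SmoothIn ρ (expLoss D f) (effDom r)) (hs : IsSampling P D ℱ ξ delay K)
    (hdelay : ∀ k ∈ Finset.Icc 1 K, ∀ ω, delay k ω ≤ τ) (ha : 0 < a) {k : ℕ}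
    (hk : k ∈ Finset.Icc 1 K) : Measurable (gradNoise D f ξ delay x k) :=
  have hpair := (hrun.adapted_delay_gradient hr hf hF hs hdelay ha hk).mono (ℱ.le k) le_rfl
  (hf.comp (hpair.fst.prodMk (hs.measurable_sample hk))).sub hpair.snd

variable [IsProbabilityMeasure P]

theorem lintegral_gradNoise_sq_le
    (hrun : IsInertialRun f r (fun _ => a) (fun _ => b) ξ delay K x₀ x)
    (hr : ProperClosedConvex r) (hf : Measurable fun p : Vec n × Ξ => sampleGrad f p.1 p.2)
    (hF : SmoothIn ρ (expLoss D f) (effDom r)) (hvar : BoundedVariance D f σ (effDom r))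
    (hs : IsSampling P D ℱ ξ delay K) (hdelay : ∀ k ∈ Finset.Icc 1 K, ∀ ω, delay k ω ≤ τ)
    (ha : 0 < a) {k : ℕ} (hk : k ∈ Finset.Icc 1 K) :
    ∫⁻ ω, ENNReal.ofReal (‖gradNoise D f ξ delay x k ω‖ ^ 2) ∂P ≤ ENNReal.ofReal (σ ^ 2) := by
  have hpair := hrun.adapted_delay_gradient hr hf hF hs hdelay ha hk
  have hG : Measurable fun p : (Vec n × Vec n) × Ξ => sampleGrad f p.1.1 p.2 - p.1.2 := by
    fun_prop
  refine lintegral_norm_sq_le_of_indepFun (hpair.mono (ℱ.le k) le_rfl) (hs.measurable_sample hk)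
    (hs.indepFun hk hpair) hG fun ω => ?_
  rw [hs.sample_law k hk]
  exact hvar _ ((hrun.isInertialPath (D := D) hdelay ω).mem_effDom_delay hk (delay k ω))

theorem integral_inner_gradNoise_eq_zero
    (hrun : IsInertialRun f r (fun _ => a) (fun _ => b) ξ delay K x₀ x)
    (hr : ProperClosedConvex r) (hf : Measurable fun p : Vec n × Ξ => sampleGrad f p.1 p.2)
    (hF : SmoothIn ρ (expLoss D f) (effDom r)) (hvar : BoundedVariance D f σ (effDom r))
    (hs : IsSampling P D ℱ ξ delay K) (hdelay : ∀ k ∈ Finset.Icc 1 K, ∀ ω, delay k ω ≤ τ)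
    (hunb : UnbiasedAlong P D f delay K x) (ha : 0 < a) {k : ℕ} (hk : k ∈ Finset.Icc 1 K)
    {u : Ω → Vec n} (hu : Measurable[ℱ k] u)
    (hint : Integrable (fun ω => ⟪u ω, gradNoise D f ξ delay x k ω⟫_ℝ) P) :
    ∫ ω, ⟪u ω, gradNoise D f ξ delay x k ω⟫_ℝ ∂P = 0 := by
  have hpair := hrun.adapted_delay_gradient hr hf hF hs hdelay ha hk
  have hG : Measurable fun p : (Vec n × Vec n) × Ξ => sampleGrad f p.1.1 p.2 - p.1.2 := by
    fun_prop
  have := hs.isProbabilityMeasure hk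
  have hnoise : ∀ ω, Integrable (fun s => sampleGrad f (x (k - delay k ω) ω) s
      - gradient (expLoss D f) (x (k - delay k ω) ω)) D := fun ω =>
    (memLp_two_of_lintegral_le (by fun_prop) (hvar _ ((hrun.isInertialPath (D := D) hdelay
      ω).mem_effDom_delay hk (delay k ω)))).integrable one_le_two
  refine integral_inner_eq_zero_of_indepFun (hpair.mono (ℱ.le k) le_rfl)
    (hu.mono (ℱ.le k) le_rfl) (hs.measurable_sample hk) (hs.indepFun hk (hu.prodMk hpair)) hG
    ?_ ?_ hint
  · simpa only [hs.sample_law k hk] using hnoise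
  · filter_upwards [hunb k hk] with ω hω
    have hgrad : Integrable (sampleGrad f (x (k - delay k ω) ω)) D := by
      simpa only [Pi.add_def, sub_add_cancel] using (hnoise ω).add (integrable_const
        (gradient (expLoss D f) (x (k - delay k ω) ω)))
    rw [hs.sample_law k hk, integral_sub hgrad (integrable_const _), hω, integral_const,
      probReal_univ, one_smul, sub_self]

theorem isNoisyInertialPath
    (hrun : IsInertialRun f r (fun _ => a) (fun _ => b) ξ delay K x₀ x)
    (hr : ProperClosedConvex r) (hf : Measurable fun p : Vec n × Ξ => sampleGrad f p.1 p.2)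
    (hF : SmoothIn ρ (expLoss D f) (effDom r)) (hvar : BoundedVariance D f σ (effDom r))
    (hs : IsSampling P D ℱ ξ delay K) (hdelay : ∀ k ∈ Finset.Icc 1 K, ∀ ω, delay k ω ≤ τ)
    (hunb : UnbiasedAlong P D f delay K x) (ha : 0 < a) :
    IsNoisyInertialPath P ℱ (expLoss D f) r a b σ τ K delay (gradNoise D f ξ delay x) x₀ x :=
  have hnoise : ∀ k ∈ Finset.Icc 1 K, MemLp (gradNoise D f ξ delay x k) 2 P := fun _ hk =>
    memLp_two_of_lintegral_le
      (hrun.measurable_gradNoise hr hf hF hs hdelay ha hk).aestronglyMeasurable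
      (hrun.lintegral_gradNoise_sq_le hr hf hF hvar hs hdelay ha hk)
  { path := hrun.isInertialPath hdelay
    init := hrun.init_zero
    adapted := hrun.adapted hr hf hs ha
    delay_adapted := hs.delay_meas
    noise_memLp := hnoise
    noise_sq_le := fun k hk => integral_norm_sq_le_of_lintegral_le (hnoise k hk).1 (sq_nonneg σ)
      (hrun.lintegral_gradNoise_sq_le hr hf hF hvar hs hdelay ha hk)
    noise_orthogonal := fun k hk _ hu hu2 => hrun.integral_inner_gradNoise_eq_zero hr hf hF hvar hs
      hdelay hunb ha hk hu (integrable_inner_of_memLp_two hu2 (hnoise k hk)) }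

end IsInertialRun

/-! ### Stepsizes `α / √K` and inertia `β / K^(1/4)` -/

theorem IsInertialRun.congr {n : ℕ} {Ω Ξ : Type*} {f : Vec n → Ξ → ℝ} {r : Vec n → EReal}
    {a a' b b' : ℕ → ℝ} {ξ : ℕ → Ω → Ξ} {delay : ℕ → Ω → ℕ} {K : ℕ} {x₀ : Vec n}
    {x : ℕ → Ω → Vec n} (hrun : IsInertialRun f r a b ξ delay K x₀ x)
    (ha : ∀ k ∈ Finset.Icc 1 K, a k = a' k) (hb : ∀ k ∈ Finset.Icc 1 K, b k = b' k) :
    IsInertialRun f r a' b' ξ delay K x₀ x where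
  __ := hrun
  step k hk ω := ha k hk ▸ hb k hk ▸ hrun.step k hk ω

theorem IsRandomIndex.congr {n : ℕ} {Ω : Type*} [MeasurableSpace Ω] {P : Measure Ω}
    {a a' : ℕ → ℝ} {K : ℕ} {x : ℕ → Ω → Vec n} {T : Ω → ℕ} (hT : IsRandomIndex P a K x T)
    (ha : ∀ k ∈ Finset.Icc 1 K, a k = a' k) : IsRandomIndex P a' K x T where
  __ := hT
  law k hk := by rw [hT.law k hk, ha k hk, Finset.sum_congr rfl ha]

theorem div_sqrt_mul_natCast (α : ℝ) (K : ℕ) : α / √K * K = α * √K := by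
  rw [div_mul_eq_mul_div, mul_div_assoc, Real.div_sqrt]

theorem div_sqrt_sq_mul_natCast (α : ℝ) {K : ℕ} (hK : 0 < K) : (α / √K) ^ 2 * K = α ^ 2 := by
  rw [div_pow, Real.sq_sqrt K.cast_nonneg, div_mul_cancel₀ _ (Nat.cast_ne_zero.2 hK.ne')]

theorem rpow_one_fourth_sq (K : ℕ) : ((K : ℝ) ^ (1 / 4 : ℝ)) ^ 2 = √K := by
  rw [← Real.rpow_mul_natCast K.cast_nonneg, Real.sqrt_eq_rpow]
  norm_num

theorem descentRate_scaled (ρ α β : ℝ) (τ K : ℕ) :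
    descentRate ρ (α / √K) (β / (K : ℝ) ^ (1 / 4 : ℝ)) τ
      = 1 / 2 - α * ρ / (2 * √K) - (τ : ℝ) ^ 2 * α ^ 2 * ρ ^ 2 / K - β / (K : ℝ) ^ (1 / 4 : ℝ) := by
  rw [descentRate, div_pow, Real.sq_sqrt K.cast_nonneg]
  ring

theorem errorCoeff_scaled (ρ ρbar α β : ℝ) (τ K : ℕ) :
    errorCoeff ρ ρbar (α / √K) (β / (K : ℝ) ^ (1 / 4 : ℝ)) τ
      = ρbar * (2 + 4 * √K / (α * (ρbar - ρ))) * (β ^ 2 / √K)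
        + (τ : ℝ) ^ 2 * ρbar * ρ ^ 2 / 2 * (α ^ 2 / K + α / ((ρbar - ρ) * √K)) := by
  rw [errorCoeff, div_pow, div_pow, rpow_one_fourth_sq, Real.sq_sqrt K.cast_nonneg,
    div_mul_eq_mul_div, div_div_eq_mul_div, div_div, mul_comm √(K : ℝ) (ρbar - ρ)]

end InertialSGM

theorem mainTheorem2 {n : ℕ} {Ω Ξ : Type*} {mΩ : MeasurableSpace Ω} [MeasurableSpace Ξ]
    -- the problem: loss `f`, law `D` of the random sample, regularizer `r`
    (P : MeasureTheory.Measure Ω) [MeasureTheory.IsProbabilityMeasure P]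
    (D : MeasureTheory.Measure Ξ) [MeasureTheory.IsProbabilityMeasure D]
    (r : Vec n → EReal) (hr : ProperClosedConvex r)
    (f : Vec n → Ξ → ℝ) (hf_int : ∀ x, MeasureTheory.Integrable (f x) D)
    (hf_diff : ∀ x ∈ effDom r, ∀ᵐ s ∂D, DifferentiableAt ℝ (fun y => f y s) x)
    (hf_meas : Measurable (fun p : Vec n × Ξ => sampleGrad f p.1 p.2))
    (F : Vec n → ℝ) (hF : F = expLoss D f)
    (φ : Vec n → EReal) (hφ : φ = objective F r) (hφ_bdd : (⨅ x, φ x) ≠ ⊥)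
    -- smoothness and bounded variance
    (ρ σ : ℝ) (hρ : 0 ≤ ρ) (hσ : 0 ≤ σ)
    (hsmooth : SmoothIn ρ F (effDom r))
    (hvar : BoundedVariance D f σ (effDom r))
    -- parameters
    (ρbar : ℝ) (hρbar : ρ < ρbar) (K : ℕ) (hK : 1 ≤ K) (τ : ℕ)
    (α β : ℝ) (hα : 0 < α) (hβ : 0 ≤ β)
    (hstep : α / √(K : ℝ) ≤ 1 / ρbar)
    (γ : ℝ)
    (hγ : γ = 1 / 2 - α * ρ / (2 * √(K : ℝ)) - (τ : ℝ) ^ 2 * α ^ 2 * ρ ^ 2 / K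
      - β / (K : ℝ) ^ (1 / 4 : ℝ))
    (hγ_pos : 0 < γ)
    -- the run of the algorithm, with bounded delays and unbiased sample gradients
    (a b : ℕ → ℝ) (ha : ∀ k ∈ Finset.Icc 1 K, a k = α / √(K : ℝ))
    (hb : ∀ k ∈ Finset.Icc 1 K, b k = β / (K : ℝ) ^ (1 / 4 : ℝ))
    (ℱ : MeasureTheory.Filtration ℕ mΩ) (ξ : ℕ → Ω → Ξ) (delay : ℕ → Ω → ℕ)
    (hsample : IsSampling P D ℱ ξ delay K)
    (hdelay : ∀ k ∈ Finset.Icc 1 K, ∀ ω, delay k ω ≤ τ)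
    (x₀ : Vec n) (x : ℕ → Ω → Vec n)
    (hrun : IsInertialRun f r a b ξ delay K x₀ x)
    (hunbiased : UnbiasedAlong P D f delay K x)
    (T : Ω → ℕ) (hT : IsRandomIndex P a K x T) :
    Differentiable ℝ (moreau (1 / ρbar) φ) ∧
    MeasureTheory.Integrable (fun ω => ‖gradient (moreau (1 / ρbar) φ) (x (T ω) ω)‖ ^ 2) P ∧
    ∫ ω, ‖gradient (moreau (1 / ρbar) φ) (x (T ω) ω)‖ ^ 2 ∂P
      ≤ 8 * ρbar / ((ρbar - ρ) * α * √(K : ℝ)) *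
        (moreau (1 / ρbar) φ x₀ - optVal φ + σ ^ 2 * ρbar * α ^ 2 / 2
          + 1 / γ *
            (ρbar * (2 + 4 * √(K : ℝ) / (α * (ρbar - ρ))) * (β ^ 2 / √(K : ℝ))
              + (τ : ℝ) ^ 2 * ρbar * ρ ^ 2 / 2
                * (α ^ 2 / K + α / ((ρbar - ρ) * √(K : ℝ)))) *
            (α / √(K : ℝ) * ((φ x₀).toReal - optVal φ) + α ^ 2 * σ ^ 2)) := by
  subst hF hφ
  have ha_pos : 0 < α / √(K : ℝ) := by positivity
  have hb_nonneg : 0 ≤ β / (K : ℝ) ^ (1 / 4 : ℝ) := by positivity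
  have haρ : α / √(K : ℝ) * ρbar ≤ 1 := (le_div_iff₀ (hρ.trans_lt hρbar)).1 hstep
  rw [← descentRate_scaled] at hγ
  subst hγ
  have hx := (hrun.congr ha hb).isNoisyInertialPath hr hf_meas hsmooth hvar hsample hdelay
    hunbiased ha_pos
  have hT_const := hT.congr ha
  refine ⟨fun y => (hasGradientAt_moreau hr hsmooth hφ_bdd (one_div_pos.2 (hρ.trans_lt hρbar))
      (one_div_mul_lt_one hρ hρbar) y).differentiableAt,
    hx.integrable_norm_gradient_moreau_sq_randomIndex hr hsmooth hφ_bdd hρ hρbar ha_pos hb_nonneg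
      hγ_pos hK hT_const, ?_⟩
  have hbound := hx.integral_norm_gradient_moreau_sq_randomIndex_le hr hsmooth hφ_bdd hρ hρbar
    ha_pos hb_nonneg haρ hγ_pos hK hT_const
  rwa [div_sqrt_mul_natCast, ← mul_assoc (ρbar - ρ), ← mul_assoc (_ ^ 2) (K : ℝ),
    div_sqrt_sq_mul_natCast _ hK, errorCoeff_scaled,
    show ρbar / 2 * (α ^ 2 * σ ^ 2) = σ ^ 2 * ρbar * α ^ 2 / 2 by ring] at hbound
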